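/- **Definitions.** In a strategic game with finite player set $N$, strategy sets $\Sigma_i$ and utilities $u_i:\prod_j\Sigma_j\to\mathbb R$, the *state graph* has the strategy profiles as vertices and an arc from $S$ to $S'$ whenever $S'$ is obtained from $S$ by changing the strategy of a single player $i$ and $u_i(S')>u_i(S)$. A *sink equilibrium* is a strongly connected component of the state graph that no arc leaves; it is *non-singleton* if it contains at least two profiles (equivalently, it is not just a pure Nash equilibrium). An *anonymous game* with $n$ players and $k$ strategies is a game in which all players have the same set of $k$ strategies and the utility of player $i$ depends only on $i$, on the strategy $a$ that $i$ plays, and on the numbers $(c_b)_b$, $\sum_b c_b=n-1$, of other players on each strategy $b$. Utilities are integers, and a game is given explicitly, by $n$ and $k$ in unary and the table of all values $u_i(a,c)$ in binary. The problem HAS A NON-SINGLETON SINK asks whether a given game has a non-singleton sink equilibrium. **Theorem.** HAS A NON-SINGLETON SINK is PSPACE-hard for anonymous games: every language $L\subseteq\{0,1\}^*$ in PSPACE admits a polynomial-time computable function $f$ that maps each word $w$ to (the encoding of) an anonymous game such that $w\in L$ if and only if $f(w)$ has a non-singleton sink equilibrium. Moreover, the problem remains PSPACE-hard when restricted to anonymous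 games with a constant-size strategy set: there is a constant $k$, independent of $L$, such that for every $L$ in PSPACE the function $f$ can be chosen so that all games $f(w)$ have exactly $k$ strategies. -/

import Mathlib

/-! ### Strategic games, state graphs and sink equilibria -/

/-- A strategic game with set of players `N`, strategy sets `S i` and utilities `u i`. -/
structure StrategicGame (N : Type*) (S : N → Type*) where
  utility : N → (∀ i, S i) → ℝ

namespace StrategicGame

variable {N : Type*} {S : N → Type*} [DecidableEq N]

/-- The arcs of the state graph: `t` is obtained from `s` by a move of a single player that
(strictly) improves the utility of that player. -/
def Arc (G : StrategicGame N S) (s t : ∀ i, S i) : Prop :=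
  ∃ (i : N) (x : S i), t = Function.update s i x ∧ G.utility i s < G.utility i t

/-- `t` is reachable from `s` by a (possibly empty) directed walk in the state graph. -/
def Reach (G : StrategicGame N S) : (∀ i, S i) → (∀ i, S i) → Prop :=
  Relation.ReflTransGen G.Arc

/-- `T` is a strongly connected component of the state graph. -/
def IsStronglyConnectedComponent (G : StrategicGame N S) (T : Set (∀ i, S i)) : Prop :=
  ∃ s, T = {t | G.Reach s t ∧ G.Reach t s}

/-- A sink equilibrium: a strongly connected component of the state graph without outgoing arcs. -/
def IsSinkEquilibrium (G : StrategicGame N S) (T : Set (∀ i, S i)) : Prop :=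
  G.IsStronglyConnectedComponent T ∧ ∀ s ∈ T, ∀ t, G.Arc s t → t ∈ T

/-- The game has a sink equilibrium with at least two states. -/
def HasNonSingletonSink (G : StrategicGame N S) : Prop :=
  ∃ T, G.IsSinkEquilibrium T ∧ T.Nontrivial

end StrategicGame

/-! ### Anonymous games -/

/-- The ways in which `m` players can be distributed over `k` strategies: `c a` is the number
of players on strategy `a`. -/
abbrev StrategyPartition (k m : ℕ) : Type :=
  {c : Fin k → ℕ // ∑ a, c a = m}

/-- An anonymous game (with integer utilities): all players have the same strategy set, and
`utility i a c` is the utility of player `i` on strategy `a` when, for every strategy `b`,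
exactly `c b` of the other players are on `b`. -/
structure AnonymousGame where
  numPlayers : ℕ
  numStrategies : ℕ
  utility : Fin numPlayers → Fin numStrategies →
    StrategyPartition numStrategies (numPlayers - 1) → ℤ

/-- The numbers of players other than `i` on each of the strategies in the profile `s`. -/
def othersPartition {n k : ℕ} (s : Fin n → Fin k) (i : Fin n) : StrategyPartition k (n - 1) :=
  ⟨fun a => (Finset.univ.filter fun j => j ≠ i ∧ s j = a).card, by
    have h := Finset.card_eq_sum_card_fiberwise (f := s) (s := Finset.univ.erase i)
      (t := Finset.univ) (fun _ _ => Finset.mem_coe.2 (Finset.mem_univ _))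
    rw [Finset.card_erase_of_mem (Finset.mem_univ i), Finset.card_univ, Fintype.card_fin] at h
    rw [h]
    refine Finset.sum_congr rfl fun a _ => congrArg Finset.card ?_
    ext j
    simp⟩

namespace AnonymousGame

/-- The strategic game that an anonymous game describes. -/
noncomputable def toStrategicGame (G : AnonymousGame) :
    StrategicGame (Fin G.numPlayers) (fun _ => Fin G.numStrategies) where
  utility i s := (G.utility i (s i) (othersPartition s i) : ℝ)

/-! ### Anonymous games as strings

A game with `n` players and `k` strategies is written as `1ⁿ 0 1ᵏ 0` followed by the table of all
utilities, in lexicographic order of (player, strategy, partition of the other players). -/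

/-- Self-delimiting binary code of an integer: a sign bit, then each binary digit of the
absolute value preceded by a `1`, then a `0`. -/
def encodeInt (z : ℤ) : List Bool :=
  decide (z < 0) :: ((Computability.encodeNat z.natAbs).flatMap (fun b => [true, b]) ++ [false])

/-- All partitions, in lexicographic order. -/
def partitionList (k m : ℕ) : List (StrategyPartition k m) :=
  (List.Nat.antidiagonalTuple k m).attachWith (fun c => ∑ a, c a = m)
    (fun _ hc => List.Nat.mem_antidiagonalTuple.1 hc)

/-- The positions of the utility table of a game with `n` players and `k` strategies. -/
def tableIndices (n k : ℕ) : List (Fin n × Fin k × StrategyPartition k (n - 1)) :=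
  List.finRange n ×ˢ List.finRange k ×ˢ partitionList k (n - 1)

/-- The string that describes an anonymous game. -/
def encode (G : AnonymousGame) : List Bool :=
  List.replicate G.numPlayers true ++ false :: (List.replicate G.numStrategies true ++ false ::
    (tableIndices G.numPlayers G.numStrategies).flatMap
      fun x => encodeInt (G.utility x.1 x.2.1 x.2.2))

theorem replicate_append_inj {m n : ℕ} {r s : List Bool}
    (h : List.replicate m true ++ false :: r = List.replicate n true ++ false :: s) :
    m = n ∧ r = s := by
  induction m generalizing n with
  | zero => cases n <;> simp_all [List.replicate_succ]
  | succ m ih =>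
    cases n with
    | zero => simp [List.replicate_succ] at h
    | succ n =>
      simp only [List.replicate_succ, List.cons_append, List.cons.injEq, true_and] at h
      exact ⟨congrArg _ (ih h).1, (ih h).2⟩

theorem digits_append_inj {l l' r s : List Bool}
    (h : l.flatMap (fun b => [true, b]) ++ false :: r =
      l'.flatMap (fun b => [true, b]) ++ false :: s) : l = l' ∧ r = s := by
  induction l generalizing l' with
  | nil => cases l' <;> simp_all
  | cons a l ih =>
    cases l' with
    | nil => simp at h
    | cons b l' =>
      simp only [List.flatMap_cons, List.cons_append, List.nil_append, List.cons.injEq,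
        true_and] at h
      obtain ⟨h1, h2⟩ := ih h.2
      exact ⟨by rw [h.1, h1], h2⟩

theorem encodeInt_append_inj {z z' : ℤ} {r s : List Bool}
    (h : encodeInt z ++ r = encodeInt z' ++ s) : z = z' ∧ r = s := by
  simp only [encodeInt, List.cons_append, List.append_assoc, List.nil_append,
    List.cons.injEq, decide_eq_decide] at h
  obtain ⟨hs, h⟩ := h
  obtain ⟨h1, h2⟩ := digits_append_inj h
  have h3 : z.natAbs = z'.natAbs := by
    rw [← Computability.decode_encodeNat z.natAbs, h1, Computability.decode_encodeNat]
  exact ⟨by omega, h2⟩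

theorem table_inj {α : Type} {g g' : α → ℤ} (l : List α)
    (h : l.flatMap (fun x => encodeInt (g x)) = l.flatMap (fun x => encodeInt (g' x))) :
    ∀ x ∈ l, g x = g' x := by
  induction l with
  | nil => simp
  | cons a l ih =>
    rw [List.flatMap_cons, List.flatMap_cons] at h
    obtain ⟨h1, h2⟩ := encodeInt_append_inj h
    intro x hx
    rcases List.mem_cons.1 hx with rfl | hx
    · exact h1
    · exact ih h2 x hx

theorem mem_tableIndices {n k : ℕ} (x : Fin n × Fin k × StrategyPartition k (n - 1)) :
    x ∈ tableIndices n k := by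
  obtain ⟨i, a, c, hc⟩ := x
  simp [tableIndices, partitionList, List.mem_attachWith, hc, List.Nat.mem_antidiagonalTuple]

theorem encode_injective : Function.Injective encode := by
  rintro ⟨n, k, u⟩ ⟨n', k', u'⟩ h
  obtain ⟨rfl, h⟩ := replicate_append_inj h
  obtain ⟨rfl, h⟩ := replicate_append_inj h
  have h' := table_inj (α := Fin n × Fin k × StrategyPartition k (n - 1))
    (g := fun x => u x.1 x.2.1 x.2.2) (g' := fun x => u' x.1 x.2.1 x.2.2) _ h
  congr
  funext i a c
  exact h' (i, a, c) (mem_tableIndices _)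

/-- The encoding of anonymous games by bit strings. -/
noncomputable def encoding : Computability.Encoding AnonymousGame Bool where
  encode := encode
  decode := Function.partialInv encode
  decode_encode := Function.partialInv_left encode_injective

end AnonymousGame

/-! ### Polynomial space and hardness -/

/-- One step of a one-tape Turing machine that also keeps track of the position of its head. -/
def trackedStep {Γ Λ : Type} [Inhabited Γ] [Inhabited Λ] (M : Turing.TM0.Machine Γ Λ) :
    Turing.TM0.Cfg Γ Λ × ℤ → Option (Turing.TM0.Cfg Γ Λ × ℤ) := fun c =>
  (Turing.TM0.step M c.1).map fun c' =>
    (c', match M c.1.q c.1.Tape.head with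
      | some (_, Turing.TM0.Stmt.move Turing.Dir.left) => c.2 - 1
      | some (_, Turing.TM0.Stmt.move Turing.Dir.right) => c.2 + 1
      | _ => c.2)

/-- A deterministic one-tape Turing machine (with finitely many states and tape symbols) that
halts on every input, decides the language `L` by the state in which it halts, and on inputs
of length `n` only visits tape cells at distance at most `space n` from its initial position,
for a polynomial `space`. -/
structure PolySpaceDecider (L : Language Bool) where
  Γ : Type
  Λ : Type
  [finiteΓ : Finite Γ]
  [finiteΛ : Finite Λ]
  [inhabitedΓ : Inhabited Γ]
  [inhabitedΛ : Inhabited Λ]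
  machine : Turing.TM0.Machine Γ Λ
  inputSymbol : Bool → Γ
  inputSymbol_injective : Function.Injective inputSymbol
  inputSymbol_ne_blank : ∀ b, inputSymbol b ≠ default
  accept : Set Λ
  space : Polynomial ℕ
  space_bound : ∀ (w : List Bool) (c : Turing.TM0.Cfg Γ Λ) (pos : ℤ),
    StateTransition.Reaches (trackedStep machine)
      (Turing.TM0.init (w.map inputSymbol), 0) (c, pos) → |pos| ≤ space.eval w.length
  decides : ∀ w : List Bool,
    ∃ c ∈ StateTransition.eval (Turing.TM0.step machine)
      (Turing.TM0.init (w.map inputSymbol)), c.q ∈ accept ↔ w ∈ L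

/-- The complexity class PSPACE, for languages over the alphabet `{0, 1}`. -/
def InPSPACE (L : Language Bool) : Prop :=
  Nonempty (PolySpaceDecider L)

/-- The decision problem "given an instance `x ∈ C`, does `P x` hold?" is PSPACE-hard: every
language in PSPACE has a polynomial-time many-one reduction to it. Instances are given to
machines through the encoding `e`. -/
def IsPSPACEHardOn {I : Type} (e : Computability.Encoding I Bool) (C : Set I) (P : I → Prop) :
    Prop :=
  ∀ L : Language Bool, InPSPACE L → ∃ f : List Bool → I,
    Nonempty (Turing.TM2ComputableInPolyTime id e.encode f) ∧
      ∀ w, f w ∈ C ∧ (w ∈ L ↔ P (f w))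

/-! The game simulates a polynomial-space decider for `L` on `w` and can be restarted from every
state except a rejecting deadlock. Only polynomially many tape cells matter. A configuration is a
set of facts (the head position with the state, and the symbol of each cell), and a machine step is
a transition that removes two facts and adds two. This is a `TokenSystem`. Every reachable set of
facts has `size + 2` elements, so the number of facts that hold shows how far a transition has
progressed.

In the game each fact has a player, who is on strategy 1 when the fact holds. The index `t` of the
current transition is stored as the number of pool players on strategy 2, and a control player
announces a phase; identities and counts thus carry all the information that the utilities need. In
phase `consume`, with all `size + 2` facts present, the pool players may raise `t` to any value: a
guess. The two facts consumed by `t` then leave, recognising their turn by the number of other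
facts. The control player moves to `produce`, the two new facts enter, the pool players return to `t
= 0`, and `consume` resumes. A wrong guess blocks before the second removal. The control player may
then choose `reset`, where all facts and the counter are cleared; afterwards `produce` with `t = 0`
rebuilds the initial facts. Resetting is also all that remains after an accepting halt. The
exception is phase `consume` with `size` facts and a rejecting `t`: there nobody can improve
(`stuck_of_reject`).

If the machine rejects, every profile reaches a profile without outgoing arcs, so all sinks are
singletons. If it accepts, the states reachable from the start are those of an intended simulation
(`Simulating.arc`) and all of them lead back (`Simulating.reach_start`), so the start lies in a
non-singleton sink. `hasNonSingletonSink_iff` combines the two directions, and `not_reject_iff`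
relates the token system to the machine.

With five strategies the number of partitions is polynomial in the number of players, so the utility
table can be written by nested counting loops. To show that this takes polynomial time, a class
`PolyTime` of functions computed by stack programs is shown to be closed under concatenation, case
distinction and bounded loops, and stack programs are translated to Turing machines
(`PolyTime.nonempty_tm2`). -/

/-! ### A flat assembly language for stack machines -/

namespace StackCode

/-- Contents of the stacks, which are numbered by natural numbers. -/
abbrev Stacks := ℕ → List Bool

/-- Instructions of a stack machine.
* `push x b` pushes `b` on stack `x`;
* `pop x ys zs l` does nothing if stack `x` is empty; otherwise it moves the top of `x` to all
  stacks in `ys`, drops the tops of the stacks in `zs`, and jumps to `l`;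
* `branch x l₀ l₁ l₂` jumps to `l₀`, `l₁` or `l₂` if the stack `x` is empty, has top `true`, or
  has top `false`. -/
inductive Instr
  | push (x : ℕ) (b : Bool)
  | pop (x : ℕ) (ys zs : List ℕ) (l : ℕ)
  | branch (x l₀ l₁ l₂ : ℕ)

/-- Push `b` on several stacks. -/
def pushAll (b : Bool) : List ℕ → Stacks → Stacks
  | [], S => S
  | y :: ys, S => pushAll b ys (Function.update S y (b :: S y))

/-- Drop the tops of several stacks. -/
def popAll : List ℕ → Stacks → Stacks
  | [], S => S
  | z :: zs, S => popAll zs (Function.update S z (S z).tail)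

/-- Effect of an instruction on a pair of a program counter and stacks. -/
def Instr.exec : Instr → ℕ × Stacks → ℕ × Stacks
  | push x b, c => (c.1 + 1, Function.update c.2 x (b :: c.2 x))
  | pop x ys zs l, c =>
    match c.2 x with
    | [] => (c.1 + 1, c.2)
    | b :: r => (l, popAll zs (pushAll b ys (Function.update c.2 x r)))
  | branch x l₀ l₁ l₂, c =>
    (match c.2 x with
      | [] => l₀
      | true :: _ => l₁
      | false :: _ => l₂, c.2)

/-- `Runs code n c c'`: the program `code` goes from `c` to `c'` in `n` steps. -/
inductive Runs (code : List Instr) : ℕ → ℕ × Stacks → ℕ × Stacks → Prop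
  | refl (c) : Runs code 0 c c
  | step {n c c' i} : code[c.1]? = some i → Runs code n (i.exec c) c' → Runs code (n + 1) c c'

theorem Runs.trans {code : List Instr} {m n : ℕ} {c₁ c₂ c₃ : ℕ × Stacks}
    (h : Runs code m c₁ c₂) (h' : Runs code n c₂ c₃) : Runs code (m + n) c₁ c₃ := by
  induction h with
  | refl => simpa using h'
  | step hi _ ih => rw [Nat.add_right_comm]; exact .step hi (ih h')

theorem Runs.single {code : List Instr} {c : ℕ × Stacks} {i : Instr} (h : code[c.1]? = some i) :
    Runs code 1 c (i.exec c) :=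
  .step h (.refl _)

/-- The equation between addresses is left to `omega`, since most uses only regroup sums of fragment
lengths. -/
theorem Runs.congr {code : List Instr} {n n' o o' : ℕ} {c : ℕ × Stacks} {S S' : Stacks}
    (h : Runs code n c (o, S)) (hn : n = n') (hS : S = S') (ho : o = o' := by omega) :
    Runs code n' c (o', S') :=
  hn ▸ hS ▸ ho ▸ h

/-- The program `frag` is the part of `code` that starts at address `o`. -/
def At (code : List Instr) (o : ℕ) (frag : List Instr) : Prop :=
  ∃ pre post, code = pre ++ (frag ++ post) ∧ pre.length = o

theorem At.left {code : List Instr} {o : ℕ} {l l' : List Instr} (h : At code o (l ++ l')) :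
    At code o l := by
  obtain ⟨pre, post, rfl, rfl⟩ := h
  exact ⟨pre, l' ++ post, by simp, rfl⟩

theorem At.right {code : List Instr} {o : ℕ} {l l' : List Instr} (h : At code o (l ++ l')) :
    At code (o + l.length) l' := by
  obtain ⟨pre, post, rfl, rfl⟩ := h
  exact ⟨pre ++ l, post, by simp, by simp⟩

theorem At.get {code : List Instr} {o : ℕ} {i : Instr} {l : List Instr}
    (h : At code o (i :: l)) : code[o]? = some i := by
  obtain ⟨pre, post, rfl, rfl⟩ := h
  simp

theorem At.tail {code : List Instr} {o : ℕ} {i : Instr} {l : List Instr}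
    (h : At code o (i :: l)) : At code (o + 1) l :=
  At.right (l := [i]) h

section Loops

variable {code : List Instr} {o x y z : ℕ}

theorem runs_clear (h : code[o]? = some (.pop x [] [] o)) (S : Stacks) :
    Runs code ((S x).length + 1) (o, S) (o + 1, Function.update S x []) := by
  generalize hl : S x = l
  induction l generalizing S with
  | nil =>
    have := Runs.single (c := (o, S)) h
    simp only [Instr.exec, hl] at this
    exact this.congr (by simp) (by rw [← hl, Function.update_eq_self])
  | cons b l ih =>
    refine .step (c := (o, S)) h ?_
    simp only [Instr.exec, hl, pushAll, popAll]
    have := ih (Function.update S x l) (by simp)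
    rwa [Function.update_idem] at this

/-- Moving symbol by symbol reverses the list, which is how reversed outputs are put back in order.
-/
theorem runs_move (h : code[o]? = some (.pop x [y] [] o)) (hxy : x ≠ y) (S : Stacks) :
    Runs code ((S x).length + 1) (o, S)
      (o + 1, Function.update (Function.update S x []) y ((S x).reverse ++ S y)) := by
  generalize hl : S x = l
  induction l generalizing S with
  | nil =>
    have := Runs.single (c := (o, S)) h
    simp only [Instr.exec, hl] at this
    exact this.congr (by simp) (by rw [← hl, Function.update_eq_self]; simp [hl])
  | cons b l ih =>
    refine .step (c := (o, S)) h ?_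
    simp only [Instr.exec, hl, pushAll, popAll]
    refine (ih _ ?_).congr rfl ?_
    · simp [hxy]
    · funext k
      by_cases hk : k = y
      · subst hk; simp [hxy.symm]
      · by_cases hk' : k = x
        · subst hk'; simp [hk]
        · simp [hk, hk']

/-- With two targets, one can serve as a backup: this is how a variable is read without being lost.
-/
theorem runs_move_two (h : code[o]? = some (.pop x [y, z] [] o)) (hxy : x ≠ y) (hxz : x ≠ z)
    (hyz : y ≠ z) (S : Stacks) :
    Runs code ((S x).length + 1) (o, S)
      (o + 1, Function.update (Function.update (Function.update S x []) y ((S x).reverse ++ S y))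
        z ((S x).reverse ++ S z)) := by
  generalize hl : S x = l
  induction l generalizing S with
  | nil =>
    have := Runs.single (c := (o, S)) h
    simp only [Instr.exec, hl] at this
    exact this.congr (by simp) (by rw [← hl, Function.update_eq_self]; simp [hl])
  | cons b l ih =>
    refine .step (c := (o, S)) h ?_
    simp only [Instr.exec, hl, pushAll, popAll]
    refine (ih _ ?_).congr rfl ?_
    · simp [hxy, hxz]
    · funext k
      by_cases hk : k = y
      · subst hk; simp [hxy.symm, hyz]
      · by_cases hk' : k = x
        · subst hk'; simp [hk, hxz]
        · by_cases hk'' : k = z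
          · subst hk''; simp [hxz.symm, hyz.symm]
          · simp [hk, hk', hk'']

/-- On unary numbers this loop is truncated subtraction. -/
theorem runs_zip (h : code[o]? = some (.pop x [] [z] o)) (hxz : x ≠ z) (S : Stacks) :
    Runs code ((S x).length + 1) (o, S)
      (o + 1, Function.update (Function.update S x []) z ((S z).drop (S x).length)) := by
  generalize hl : S x = l
  induction l generalizing S with
  | nil =>
    have := Runs.single (c := (o, S)) h
    simp only [Instr.exec, hl] at this
    exact this.congr (by simp) (by rw [← hl, Function.update_eq_self]; simp [hl])
  | cons b l ih =>
    refine .step (c := (o, S)) h ?_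
    simp only [Instr.exec, hl, pushAll, popAll]
    refine (ih _ ?_).congr rfl ?_
    · simp [hxz]
    · funext k
      by_cases hk : k = z
      · subst hk; simp [hxz.symm]
      · by_cases hk' : k = x
        · subst hk'; simp [hk]
        · simp [hk, hk']

end Loops

end StackCode

theorem Polynomial.eval_mono_nat (P : Polynomial ℕ) : Monotone fun n => P.eval n := by
  intro m n h
  simp only [Polynomial.eval_eq_sum, Polynomial.sum]
  gcongr

/-! ### Functions computed in polynomial time by stack programs -/

namespace StackCode

/-- The total length of the variables in the context `Γ`. -/
def size {α : Type} {d : ℕ} (Γ : Fin d → α → List Bool) (a : α) : ℕ :=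
  ∑ i, (Γ i a).length

/-- The context `Γ` with an additional variable. -/
def ext {α : Type} {d : ℕ} (Γ : Fin d → α → List Bool) : Fin (d + 1) → α × List Bool → List Bool :=
  Fin.cons Prod.snd fun i p => Γ i p.1

theorem size_ext {α : Type} {d : ℕ} (Γ : Fin d → α → List Bool) (p : α × List Bool) :
    size (ext Γ) p = p.2.length + size Γ p.1 := by
  simp [size, ext, Fin.sum_univ_succ]

/-- The function `f` of the variables in `Γ` is computed by a program that runs in polynomial
time and appends the result to any given stack. -/
def PolyTime {α : Type} {d : ℕ} (Γ : Fin d → α → List Bool) (f : α → List Bool) : Prop :=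
  -- Length and time bound do not depend on the address or on the stacks used, so fragments can be
  -- relocated and composed. Stack 0 is scratch space, the stacks from `s` on are free, and all of
  -- them are empty again at the end. The result is pushed, hence reversed, on top of `out`, so that
  -- concatenation amounts to running two fragments in succession.
  ∃ (len : ℕ) (P : Polynomial ℕ), (∀ a, (f a).length ≤ P.eval (size Γ a)) ∧
    ∀ (o out s : ℕ) (ρ : Fin d → ℕ), 0 < out → out < s →
      (∀ i, 0 < ρ i ∧ ρ i < s ∧ ρ i ≠ out) →
      ∃ frag : List Instr, frag.length = len ∧ ∀ code, At code o frag → ∀ (a : α) (S : Stacks),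
        S 0 = [] → (∀ k, s ≤ k → S k = []) → (∀ i, S (ρ i) = Γ i a) →
        ∃ n ≤ P.eval (size Γ a), Runs code n (o, S)
          (o + len, Function.update S out ((f a).reverse ++ S out))

/-- A variant of `PolyTime` in which the result is put on the first free stack. -/
theorem PolyTime.toStack {α : Type} {d : ℕ} {Γ : Fin d → α → List Bool} {f : α → List Bool}
    (hf : PolyTime Γ f) :
    ∃ (len : ℕ) (P : Polynomial ℕ), (∀ a, (f a).length ≤ P.eval (size Γ a)) ∧
    ∀ (o s : ℕ) (ρ : Fin d → ℕ), 0 < s → (∀ i, 0 < ρ i ∧ ρ i < s) →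
      ∃ frag : List Instr, frag.length = len ∧ ∀ code, At code o frag → ∀ (a : α) (S : Stacks),
        S 0 = [] → (∀ k, s ≤ k → S k = []) → (∀ i, S (ρ i) = Γ i a) →
        ∃ n ≤ P.eval (size Γ a), Runs code n (o, S) (o + len, Function.update S s (f a)) := by
  obtain ⟨len, P, hP, hf⟩ := hf
  refine ⟨len + 1, P + P + 1, fun a => (hP a).trans (by simp; omega), fun o s ρ hs hρ => ?_⟩
  -- The reversed result is collected on stack `s + 1`; moving it to `s` restores the order.
  obtain ⟨frag, rfl, hfrag⟩ := hf o (s + 1) (s + 2) ρ (by omega) (by omega)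
    fun i => by have := hρ i; omega
  refine ⟨frag ++ [.pop (s + 1) [s] [] (o + frag.length)], by simp, fun code hc a S h0 hS hΓ => ?_⟩
  obtain ⟨n, hn, hrun⟩ := hfrag code hc.left a S h0 (fun k hk => hS k (by omega)) hΓ
  have h2 := runs_move hc.right.get (by omega)
    (Function.update S (s + 1) ((f a).reverse ++ S (s + 1)))
  refine ⟨_, ?_, (hrun.trans h2).congr rfl ?_⟩
  · have := hP a
    simp [hS (s + 1) (by omega)]
    omega
  · funext k
    by_cases hk : k = s
    · subst hk; simp [hS]
    · by_cases hk' : k = s + 1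
      · subst hk'; simp [hS]
      · simp [hk, hk']

section Closure

variable {α : Type} {d : ℕ} {Γ : Fin d → α → List Bool}

theorem PolyTime.nil : PolyTime Γ fun _ => [] :=
  ⟨0, 1, by simp, fun o out s ρ _ _ _ =>
    ⟨[], rfl, fun code _ a S _ _ _ => ⟨0, by simp, by simpa using .refl _⟩⟩⟩

theorem PolyTime.single (b : Bool) : PolyTime Γ fun _ => [b] :=
  ⟨1, 1, by simp, fun o out s ρ _ _ _ =>
    ⟨[.push out b], rfl, fun code hc a S _ _ _ => ⟨1, by simp, .single (c := (o, S)) hc.get⟩⟩⟩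

theorem PolyTime.append {f g : α → List Bool} (hf : PolyTime Γ f) (hg : PolyTime Γ g) :
    PolyTime Γ fun a => f a ++ g a := by
  obtain ⟨m, P, hP, hf⟩ := hf
  obtain ⟨n, Q, hQ, hg⟩ := hg
  refine ⟨m + n, P + Q, fun a => by simpa using Nat.add_le_add (hP a) (hQ a),
    fun o out s ρ h1 h2 hρ => ?_⟩
  obtain ⟨F, rfl, hF⟩ := hf o out s ρ h1 h2 hρ
  obtain ⟨G, rfl, hG⟩ := hg (o + F.length) out s ρ h1 h2 hρ
  refine ⟨F ++ G, by simp, fun code hc a S h0 hS hΓ => ?_⟩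
  obtain ⟨k, hk, hrun⟩ := hF code hc.left a S h0 hS hΓ
  obtain ⟨k', hk', hrun'⟩ := hG code hc.right a
    (Function.update S out ((f a).reverse ++ S out)) (by simp [h1.ne, h0])
    (fun k hk => by simp [show k ≠ out by omega, hS k hk])
    (fun i => by simp [(hρ i).2.2, hΓ])
  refine ⟨k + k', by simpa using Nat.add_le_add hk hk', ?_⟩
  have := hrun.trans hrun'
  simpa [Nat.add_assoc] using this

theorem PolyTime.var (i : Fin d) : PolyTime Γ (Γ i) := by
  have hsz : ∀ a, (Γ i a).length ≤ size Γ a := fun a =>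
    Finset.single_le_sum (f := fun i => (Γ i a).length) (by simp) (Finset.mem_univ i)
  refine ⟨2, 2 * Polynomial.X + 2, fun a => (hsz a).trans (by simp; omega),
    fun o out s ρ h1 h2 hρ => ?_⟩
  -- The variable is emptied onto the scratch stack and the output at once, then restored from the
  -- scratch stack.
  refine ⟨[.pop (ρ i) [0, out] [] o, .pop 0 [ρ i] [] (o + 1)], rfl,
    fun code hc a S h0 hS hΓ => ?_⟩
  have hi := hρ i
  have r1 := runs_move_two hc.get (by omega) hi.2.2 (by omega) S
  refine ⟨_, ?_, (r1.trans (runs_move hc.tail.get (by omega) _)).congr rfl ?_⟩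
  · have := hsz a
    simp [h1.ne, h0, hΓ]
    omega
  · have h3 : out ≠ 0 := by omega
    have h4 : ρ i ≠ 0 := by omega
    funext k
    by_cases hk : k = ρ i
    · subst hk; simp [h0, hi.2.2, h3.symm, h4, hΓ]
    · by_cases hk' : k = 0
      · subst hk'; simp [hk, h0, h3.symm]
      · by_cases hk'' : k = out
        · subst hk''; simp [hk, hk', hΓ]
        · simp [hk, hk', hk'']

theorem PolyTime.weaken {f : α → List Bool} (hf : PolyTime Γ f) :
    PolyTime (ext Γ) fun p => f p.1 := by
  obtain ⟨m, P, hP, hf⟩ := hf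
  have hle : ∀ p : α × List Bool, P.eval (size Γ p.1) ≤ P.eval (size (ext Γ) p) := fun p =>
    P.eval_mono_nat (by simp [size_ext])
  refine ⟨m, P, fun p => (hP p.1).trans (hle p), fun o out s ρ h1 h2 hρ => ?_⟩
  obtain ⟨F, rfl, hF⟩ := hf o out s (fun i => ρ i.succ) h1 h2 fun i => hρ i.succ
  refine ⟨F, rfl, fun code hc p S h0 hS hΓ => ?_⟩
  obtain ⟨n, hn, hrun⟩ := hF code hc p.1 S h0 hS fun i => by simp [hΓ, ext]
  exact ⟨n, hn.trans (hle p), hrun⟩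

theorem ext_locations {a : α} {l : List Bool} {S : Stacks} {s : ℕ} {ρ : Fin d → ℕ}
    (hs : S s = l) (hΓ : ∀ i, S (ρ i) = Γ i a) (i : Fin (d + 1)) :
    S ((Fin.cons s ρ : Fin (d + 1) → ℕ) i) = ext Γ i (a, l) := by
  refine Fin.cases ?_ (fun i => ?_) i <;> simp [ext, hs, hΓ]

theorem ext_bounds {s : ℕ} {ρ : Fin d → ℕ} (h0 : 0 < s) (hρ : ∀ i, 0 < ρ i ∧ ρ i < s)
    (i : Fin (d + 1)) : 0 < (Fin.cons s ρ : Fin (d + 1) → ℕ) i ∧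
      (Fin.cons s ρ : Fin (d + 1) → ℕ) i < s + 1 := by
  refine Fin.cases ?_ (fun i => ?_) i
  · simp [h0]
  · have := hρ i
    simp only [Fin.cons_succ]
    omega

theorem ext_ne {s out : ℕ} {ρ : Fin d → ℕ} (h : out < s) (hρ : ∀ i, ρ i ≠ out)
    (i : Fin (d + 1)) : (Fin.cons s ρ : Fin (d + 1) → ℕ) i ≠ out := by
  refine Fin.cases ?_ (fun i => ?_) i
  · simpa using h.ne'
  · simpa using hρ i

theorem PolyTime.drop {f g : α → List Bool} (hf : PolyTime Γ f) (hg : PolyTime Γ g) :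
    PolyTime Γ fun a => (f a).drop (g a).length := by
  obtain ⟨m, P, hP, hf⟩ := hf.toStack
  obtain ⟨n, Q, hQ, hg⟩ := hg.weaken.toStack
  have hsz : ∀ a, Q.eval (size (ext Γ) (a, f a)) ≤ (Q.comp (P + Polynomial.X)).eval (size Γ a) := by
    intro a
    rw [Polynomial.eval_comp]
    refine Q.eval_mono_nat ?_
    simpa [size_ext] using hP a
  refine ⟨m + n + 2, 2 * P + 2 * Q.comp (P + Polynomial.X) + 2, fun a => ?_,
    fun o out s ρ h1 h2 hρ => ?_⟩
  · have := hP a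
    simp only [List.length_drop, Polynomial.eval_add, Polynomial.eval_mul, Polynomial.eval_ofNat]
    omega
  obtain ⟨F, rfl, hF⟩ := hf o s ρ (by omega) fun i => ⟨(hρ i).1, (hρ i).2.1⟩
  obtain ⟨G, rfl, hG⟩ := hg (o + F.length) (s + 1) (Fin.cons s ρ) (by omega)
    (ext_bounds (by omega) fun i => ⟨(hρ i).1, (hρ i).2.1⟩)
  refine ⟨F ++ (G ++ [.pop (s + 1) [] [s] (o + F.length + G.length),
    .pop s [out] [] (o + F.length + G.length + 1)]), by simp; omega, fun code hc a S h0 hS hΓ => ?_⟩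
  obtain ⟨k, hk, r1⟩ := hF code hc.left a S h0 hS hΓ
  obtain ⟨k', hk', r2⟩ := hG code hc.right.left (a, f a) (Function.update S s (f a))
    (by simp [show 0 ≠ s by omega, h0]) (fun j hj => by simp [show j ≠ s by omega, hS j (by omega)])
    (ext_locations (by simp) fun i => by simp [(hρ i).2.1.ne, hΓ])
  have hc' := hc.right.right
  have r3 := runs_zip hc'.get (by omega)
    (Function.update (Function.update S s (f a)) (s + 1) (g a))
  have r4 := runs_move hc'.tail.get (show s ≠ out by omega)
    (Function.update (Function.update (Function.update (Function.update S s (f a)) (s + 1) (g a))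
      (s + 1) []) s ((Function.update (Function.update S s (f a)) (s + 1) (g a) s).drop
        (Function.update (Function.update S s (f a)) (s + 1) (g a) (s + 1)).length))
  refine ⟨_, ?_, (((r1.trans r2).trans r3).trans r4).congr rfl ?_⟩
  · have h5 := hk'.trans (hsz a)
    have h6 := (hQ (a, f a)).trans (hsz a)
    have h7 := hP a
    simp only [Polynomial.eval_add, Polynomial.eval_mul, Polynomial.eval_ofNat] at *
    simp [-Polynomial.eval_comp]
    omega
  · funext j
    by_cases hj : j = out
    · subst hj; simp [h2.ne, show j ≠ s + 1 by omega]
    · by_cases hj' : j = s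
      · subst hj'; simp [hj, hS]
      · by_cases hj'' : j = s + 1
        · subst hj''; simp [hj, hS]
        · simp [hj, hj', hj'']

/-- Distinguish whether a list is empty, has head `true`, or has head `false`. -/
def headCases {β : Type} (l : List Bool) (x y z : β) : β :=
  match l with
  | [] => x
  | true :: _ => y
  | false :: _ => z

theorem PolyTime.headCases {g f₀ f₁ f₂ : α → List Bool} (hg : PolyTime Γ g)
    (hf₀ : PolyTime Γ f₀) (hf₁ : PolyTime Γ f₁) (hf₂ : PolyTime Γ f₂) :
    PolyTime Γ fun a => headCases (g a) (f₀ a) (f₁ a) (f₂ a) := by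
  obtain ⟨m, P, hP, hg⟩ := hg.toStack
  obtain ⟨n₀, Q₀, hQ₀, hf₀⟩ := hf₀
  obtain ⟨n₁, Q₁, hQ₁, hf₁⟩ := hf₁
  obtain ⟨n₂, Q₂, hQ₂, hf₂⟩ := hf₂
  refine ⟨m + n₀ + n₁ + n₂ + 7, 2 * P + Q₀ + Q₁ + Q₂ + 3, fun a => ?_,
    fun o out s ρ h1 h2 hρ => ?_⟩
  · have h₀ := hQ₀ a
    have h₁ := hQ₁ a
    have h₂ := hQ₂ a
    simp only [Polynomial.eval_add, Polynomial.eval_mul, Polynomial.eval_ofNat]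
    unfold StackCode.headCases
    split <;> omega
  obtain ⟨G, rfl, hG⟩ := hg o s ρ (by omega) fun i => ⟨(hρ i).1, (hρ i).2.1⟩
  obtain ⟨F₀, rfl, hF₀⟩ := hf₀ (o + G.length + 1 + 1) out s ρ h1 h2 hρ
  obtain ⟨F₁, rfl, hF₁⟩ := hf₁ (o + G.length + 1 + (F₀.length + 2) + 1) out s ρ h1 h2 hρ
  obtain ⟨F₂, rfl, hF₂⟩ := hf₂ (o + G.length + 1 + (F₀.length + 2) + (F₁.length + 2) + 1)
    out s ρ h1 h2 hρ
  obtain ⟨E, hE⟩ : ∃ E, E = o + (G.length + F₀.length + F₁.length + F₂.length + 7) := ⟨_, rfl⟩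
  -- One arm of the case distinction: clear the tested stack, run `F`, and leave by a `branch` with
  -- three equal targets, which is an unconditional jump to the common exit `E`.
  let B (x : ℕ) (F : List Instr) : List Instr := (.pop s [] [] x :: F) ++ [.branch 0 E E E]
  have key : ∀ (code : List Instr) (x : ℕ) (F : List Instr) (f : List Bool) (S : Stacks) (N : ℕ),
      At code x (B x F) → S 0 = [] → S s = [] →
      (∃ n ≤ N, Runs code n (x + 1, S)
        (x + 1 + F.length, Function.update S out (f.reverse ++ S out))) →
      ∀ l, ∃ n ≤ l.length + N + 2, Runs code n (x, Function.update S s l)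
        (E, Function.update S out (f.reverse ++ S out)) := by
    rintro code x F f S N hc h0 hs ⟨n, hn, hrun⟩ l
    have r1 := (runs_clear hc.left.get (Function.update S s l)).congr rfl
      (show _ = S by rw [Function.update_idem, ← hs, Function.update_eq_self]) rfl
    have hr := hc.right.get
    simp only [List.length_cons] at hr
    have r3 := Runs.single (c := (x + 1 + F.length, Function.update S out (f.reverse ++ S out)))
      (by rw [← hr]; congr 1; omega)
    simp only [Instr.exec, Function.update_of_ne h1.ne, h0] at r3
    refine ⟨_, ?_, (r1.trans hrun).trans r3⟩
    simp
    omega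
  refine ⟨G ++ (.branch s (o + G.length + 1) (o + G.length + 1 + (F₀.length + 2))
      (o + G.length + 1 + (F₀.length + 2) + (F₁.length + 2)) ::
      (B (o + G.length + 1) F₀ ++ (B (o + G.length + 1 + (F₀.length + 2)) F₁ ++
        B (o + G.length + 1 + (F₀.length + 2) + (F₁.length + 2)) F₂))), by simp [B]; omega,
    fun code hc a S h0 hS hΓ => ?_⟩
  obtain ⟨k, hk, r1⟩ := hG code hc.left a S h0 hS hΓ
  have r2 := Runs.single (c := (o + G.length, Function.update S s (g a))) hc.right.get
  have c0 := hc.right.tail.left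
  have c1 := hc.right.tail.right.left
  have c2 := hc.right.tail.right.right
  have hP := hP a
  simp only [Polynomial.eval_add, Polynomial.eval_mul, Polynomial.eval_ofNat]
  simp only [show ∀ x F, (B x F).length = F.length + 2 by intro x F; simp [B]] at c1 c2
  rw [show o + (G.length + F₀.length + F₁.length + F₂.length + 7) = E from hE.symm]
  rcases hga : g a with _ | ⟨_ | _, r⟩
  · simp only [Instr.exec, hga, Function.update_self] at r2 r1 ⊢
    obtain ⟨n, hn, r3⟩ := key code _ F₀ (f₀ a) S _ c0 h0 (hS s le_rfl)
      (hF₀ code c0.left.tail a S h0 hS hΓ) []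
    refine ⟨_, ?_, (r1.trans r2).trans r3⟩
    simp at hn
    omega
  · simp only [Instr.exec, hga, Function.update_self] at r2 r1 ⊢
    obtain ⟨n, hn, r3⟩ := key code _ F₂ (f₂ a) S _ c2 h0 (hS s le_rfl)
      (hF₂ code c2.left.tail a S h0 hS hΓ) (false :: r)
    refine ⟨_, ?_, (r1.trans r2).trans r3⟩
    rw [hga] at hP
    omega
  · simp only [Instr.exec, hga, Function.update_self] at r2 r1 ⊢
    obtain ⟨n, hn, r3⟩ := key code _ F₁ (f₁ a) S _ c1 h0 (hS s le_rfl)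
      (hF₁ code c1.left.tail a S h0 hS hΓ) (true :: r)
    refine ⟨_, ?_, (r1.trans r2).trans r3⟩
    rw [hga] at hP
    omega

/-- This is the only loop construct. The list is its own loop variable on stack `s`: each round ends
by dropping its head and jumping back. The exit test comes after the body, so the body also runs for
the empty tail. -/
theorem PolyTime.flatMap_tails {g : α → List Bool} {f : α → List Bool → List Bool}
    (hg : PolyTime Γ g) (hf : PolyTime (ext Γ) fun p => f p.1 p.2) :
    PolyTime Γ fun a => (g a).tails.flatMap (f a) := by
  obtain ⟨m, P, hP, hg⟩ := hg.toStack
  obtain ⟨n, Q, hQ, hf⟩ := hf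
  have hsz : ∀ a l, l.length ≤ P.eval (size Γ a) →
      Q.eval (size (ext Γ) (a, l)) ≤ (Q.comp (P + Polynomial.X)).eval (size Γ a) := by
    intro a l hl
    rw [Polynomial.eval_comp]
    refine Q.eval_mono_nat ?_
    simpa [size_ext] using hl
  refine ⟨m + n + 1, P + (P + 1) * (Q.comp (P + Polynomial.X) + 1), fun a => ?_,
    fun o out s ρ h1 h2 hρ => ?_⟩
  · simp only [Polynomial.eval_add, Polynomial.eval_mul, Polynomial.eval_one]
    refine le_add_left ?_
    have : ∀ l : List Bool, l.length ≤ P.eval (size Γ a) → (l.tails.flatMap (f a)).length ≤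
        (l.length + 1) * ((Q.comp (P + Polynomial.X)).eval (size Γ a) + 1) := by
      intro l
      induction l with
      | nil =>
        intro hl
        have := (hQ (a, [])).trans (hsz a [] hl)
        simp at this ⊢
        omega
      | cons b l ih =>
        intro hl
        have h3 := (hQ (a, b :: l)).trans (hsz a _ hl)
        have h4 := ih (by simp at hl; omega)
        simp only [List.tails_cons, List.flatMap_cons, List.length_append, List.length_cons] at h3 ⊢
        rw [add_mul (l.length + 1), one_mul]
        omega
    exact (this _ (hP a)).trans (by gcongr; exact hP a)
  obtain ⟨G, rfl, hG⟩ := hg o s ρ (by omega) fun i => ⟨(hρ i).1, (hρ i).2.1⟩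
  obtain ⟨F, rfl, hF⟩ := hf (o + G.length) out (s + 1) (Fin.cons s ρ) h1 (by omega)
    (fun i => ⟨(ext_bounds (by omega) (fun i => ⟨(hρ i).1, (hρ i).2.1⟩) i).1,
      (ext_bounds (by omega) (fun i => ⟨(hρ i).1, (hρ i).2.1⟩) i).2,
      ext_ne h2 (fun i => (hρ i).2.2) i⟩)
  refine ⟨G ++ (F ++ [.pop s [] [] (o + G.length)]), by simp; omega,
    fun code hc a S h0 hS hΓ => ?_⟩
  obtain ⟨k, hk, r1⟩ := hG code hc.left a S h0 hS hΓ
  have loop : ∀ (l : List Bool), l.length ≤ P.eval (size Γ a) → ∀ T : Stacks, T 0 = [] →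
      (∀ k, s ≤ k → T k = []) → (∀ i, T (ρ i) = Γ i a) →
      ∃ n ≤ (l.length + 1) * ((Q.comp (P + Polynomial.X)).eval (size Γ a) + 1),
        Runs code n (o + G.length, Function.update T s l) (o + G.length + F.length + 1,
          Function.update T out ((l.tails.flatMap (f a)).reverse ++ T out)) := by
    intro l
    induction l with
    | nil =>
      intro hl T hT0 hT hTΓ
      obtain ⟨k', hk', r2⟩ := hF code hc.right.left (a, []) (Function.update T s [])
        (by simp [show 0 ≠ s by omega, hT0])
        (fun j hj => by simp [show j ≠ s by omega, hT j (by omega)])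
        (ext_locations (by simp) fun i => by simp [(hρ i).2.1.ne, hTΓ])
      have r3 := Runs.single (c := (o + G.length + F.length,
        Function.update (Function.update T s [])
        out ((f a []).reverse ++ Function.update T s [] out))) hc.right.right.get
      simp only [Instr.exec, Function.update_of_ne h2.ne', Function.update_self] at r3
      refine ⟨_, ?_, (r2.trans r3).congr rfl ?_⟩
      · have := hk'.trans (hsz a [] hl)
        simp at this ⊢
        omega
      · rw [← hT s le_rfl, Function.update_eq_self]
        simp [hT]
    | cons b l ih =>
      intro hl T hT0 hT hTΓ
      obtain ⟨k', hk', r2⟩ := hF code hc.right.left (a, b :: l) (Function.update T s (b :: l))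
        (by simp [show 0 ≠ s by omega, hT0])
        (fun j hj => by simp [show j ≠ s by omega, hT j (by omega)])
        (ext_locations (by simp) fun i => by simp [(hρ i).2.1.ne, hTΓ])
      have r3 := Runs.single (c := (o + G.length + F.length, Function.update
        (Function.update T s (b :: l))
        out ((f a (b :: l)).reverse ++ Function.update T s (b :: l) out))) hc.right.right.get
      simp only [Instr.exec, Function.update_of_ne h2.ne', Function.update_self, popAll, pushAll]
        at r3
      obtain ⟨k'', hk'', r4⟩ := ih (by simp at hl; omega)
        (Function.update T out ((f a (b :: l)).reverse ++ T out))
        (by simp [h1.ne, hT0])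
        (fun j hj => by simp [show j ≠ out by omega, hT j (by omega)])
        (fun i => by simp [(hρ i).2.2, hTΓ])
      have hst : Function.update (Function.update T out ((f a (b :: l)).reverse ++ T out)) s l =
          Function.update (Function.update (Function.update T s (b :: l)) out
            ((f a (b :: l)).reverse ++ Function.update T s (b :: l) out)) s l := by
        funext j
        by_cases hj : j = s
        · subst hj; simp
        · by_cases hj' : j = out
          · subst hj'; simp [hj]
          · simp [hj, hj']
      rw [hst] at r4
      refine ⟨k' + (1 + k''), ?_, (r2.trans (r3.trans r4)).congr rfl ?_⟩
      · have := hk'.trans (hsz a _ hl)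
        rw [List.length_cons, add_mul (l.length + 1), one_mul]
        omega
      · simp
  obtain ⟨k', hk', r2⟩ := loop (g a) (hP a) S h0 hS hΓ
  refine ⟨k + k', ?_, ?_⟩
  · simp only [Polynomial.eval_add, Polynomial.eval_mul, Polynomial.eval_one] at *
    refine Nat.add_le_add hk (hk'.trans ?_)
    gcongr
    exact hP a
  · have := r1.trans r2
    simpa [Nat.add_assoc] using this

end Closure

end StackCode

/-! ### Translation of stack programs to Turing machines -/

namespace StackCode

/-- The instruction only refers to stacks up to `m`. -/
def Instr.Bounded (m : ℕ) : Instr → Prop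
  | push x _ => x ≤ m
  | pop x ys zs _ => x ≤ m ∧ (∀ y ∈ ys, y ≤ m) ∧ ∀ z ∈ zs, z ≤ m
  | branch x _ _ _ => x ≤ m

theorem exists_le_of_list (l : List ℕ) : ∃ m, ∀ y ∈ l, y ≤ m :=
  ⟨l.sum, fun _ h => List.le_sum_of_mem h⟩

theorem Instr.Bounded.mono {m n : ℕ} (h : m ≤ n) {i : Instr} (hi : i.Bounded m) : i.Bounded n := by
  cases i with
  | push x b => exact hi.trans h
  | pop x ys zs l =>
    exact ⟨hi.1.trans h, fun y hy => (hi.2.1 y hy).trans h, fun y hy => (hi.2.2 y hy).trans h⟩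
  | branch x _ _ _ => exact hi.trans h

theorem exists_bounded (code : List Instr) : ∃ m, ∀ i ∈ code, i.Bounded m := by
  induction code with
  | nil => exact ⟨0, by simp⟩
  | cons i l ih =>
    obtain ⟨m, hm⟩ := ih
    have : ∃ n, i.Bounded n := by
      cases i with
      | push x b => exact ⟨x, le_rfl⟩
      | pop x ys zs l =>
        obtain ⟨a, ha⟩ := exists_le_of_list ys
        obtain ⟨b, hb⟩ := exists_le_of_list zs
        exact ⟨x + a + b, by omega, fun y hy => by have := ha y hy; omega,
          fun y hy => by have := hb y hy; omega⟩
      | branch x _ _ _ => exact ⟨x, le_rfl⟩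
    obtain ⟨n, hn⟩ := this
    refine ⟨m + n, fun j hj => ?_⟩
    rcases List.mem_cons.1 hj with rfl | hj
    · exact hn.mono (by omega)
    · exact (hm j hj).mono (by omega)

section Translation

variable (m len : ℕ)

/-- Statements of the Turing machine with stacks `0, …, m` and labels `0, …, len`. -/
abbrev TMStmt : Type := Turing.TM2.Stmt (fun _ : Fin (m + 1) => Bool) (Fin (len + 1)) (Option Bool)

/-- Forget the symbol that was read last and go to `l`. -/
def jump (l : ℕ) : TMStmt m len :=
  .load (fun _ => none) (.goto fun _ => Fin.ofNat (len + 1) l)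

/-- Push the symbol that was read last on the stacks `ys`. -/
def pushStmt : List ℕ → TMStmt m len → TMStmt m len
  | [], q => q
  | y :: ys, q => .push (Fin.ofNat (m + 1) y) (fun v => v.getD true) (pushStmt ys q)

/-- Drop the tops of the stacks `zs`. -/
def popStmt : List ℕ → TMStmt m len → TMStmt m len
  | [], q => q
  | z :: zs, q => .pop (Fin.ofNat (m + 1) z) (fun v _ => v) (popStmt zs q)

/-- The translation of an instruction at address `pc`. -/
def Instr.toStmt (pc : ℕ) : Instr → TMStmt m len
  | push x b => .push (Fin.ofNat (m + 1) x) (fun _ => b) (jump m len (pc + 1))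
  | pop x ys zs l => .pop (Fin.ofNat (m + 1) x) (fun _ o => o)
      (.branch Option.isNone (jump m len (pc + 1))
        (pushStmt m len ys (popStmt m len zs (jump m len l))))
  | branch x l₀ l₁ l₂ => .peek (Fin.ofNat (m + 1) x) (fun _ o => o)
      (.branch Option.isNone (jump m len l₀)
        (.branch (fun v => v == some true) (jump m len l₁) (jump m len l₂)))

/-- The configuration of the Turing machine for a pair of a program counter and stacks. -/
def toCfg (c : ℕ × Stacks) :
    Turing.TM2.Cfg (fun _ : Fin (m + 1) => Bool) (Fin (len + 1)) (Option Bool) :=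
  ⟨some (Fin.ofNat (len + 1) c.1), none, fun k => c.2 k⟩

variable {m len}

theorem restrict_update {x : ℕ} (hx : x ≤ m) (S : Stacks) (l : List Bool) :
    Function.update (fun k : Fin (m + 1) => S k) (Fin.ofNat (m + 1) x) l =
      fun k : Fin (m + 1) => Function.update S x l k := by
  funext k
  by_cases h : (k : ℕ) = x
  · have : k = Fin.ofNat (m + 1) x := by
      ext
      simp [h, Nat.mod_eq_of_lt (Nat.lt_succ_of_le hx)]
    subst this
    simp [Nat.mod_eq_of_lt (Nat.lt_succ_of_le hx)]
  · have : k ≠ Fin.ofNat (m + 1) x := by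
      rintro rfl
      simp [Nat.mod_eq_of_lt (Nat.lt_succ_of_le hx)] at h
    rw [Function.update_of_ne this, Function.update_of_ne h]

theorem val_ofNat {x : ℕ} (hx : x ≤ m) : ((Fin.ofNat (m + 1) x : Fin (m + 1)) : ℕ) = x := by
  simp [Nat.mod_eq_of_lt (Nat.lt_succ_of_le hx)]

theorem stepAux_jump (l : ℕ) (v : Option Bool) (S : Stacks) :
    Turing.TM2.stepAux (jump m len l) v (fun k : Fin (m + 1) => S k) = toCfg m len (l, S) := by
  simp [jump, Turing.TM2.stepAux, toCfg]

theorem stepAux_pushStmt (q : TMStmt m len) (b : Bool) (ys : List ℕ) (h : ∀ y ∈ ys, y ≤ m)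
    (S : Stacks) :
    Turing.TM2.stepAux (pushStmt m len ys q) (some b) (fun k : Fin (m + 1) => S k) =
      Turing.TM2.stepAux q (some b) (fun k : Fin (m + 1) => pushAll b ys S k) := by
  induction ys generalizing S with
  | nil => rfl
  | cons y ys ih =>
    have hy := h y (by simp)
    simp only [pushStmt, Turing.TM2.stepAux, Option.getD_some, pushAll, val_ofNat hy]
    rw [restrict_update hy, ih fun z hz => h z (by simp [hz])]

theorem stepAux_popStmt (q : TMStmt m len) (v : Option Bool) (zs : List ℕ) (h : ∀ z ∈ zs, z ≤ m)
    (S : Stacks) :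
    Turing.TM2.stepAux (popStmt m len zs q) v (fun k : Fin (m + 1) => S k) =
      Turing.TM2.stepAux q v (fun k : Fin (m + 1) => popAll zs S k) := by
  induction zs generalizing S with
  | nil => rfl
  | cons z zs ih =>
    have hz := h z (by simp)
    simp only [popStmt, Turing.TM2.stepAux, popAll, val_ofNat hz]
    rw [restrict_update hz, ih fun z hz => h z (by simp [hz])]

/-- A whole instruction becomes a single statement, so program steps and machine steps agree in
number. -/
theorem stepAux_toStmt {i : Instr} (hi : i.Bounded m) (c : ℕ × Stacks) (v : Option Bool) :
    Turing.TM2.stepAux (i.toStmt m len c.1) v (fun k : Fin (m + 1) => c.2 k) =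
      toCfg m len (i.exec c) := by
  cases i with
  | push x b =>
    simp only [Instr.toStmt, Turing.TM2.stepAux, val_ofNat hi, Instr.exec]
    rw [restrict_update hi, stepAux_jump]
  | pop x ys zs l =>
    obtain ⟨hx, hys, hzs⟩ := hi
    simp only [Instr.toStmt, Turing.TM2.stepAux, val_ofNat hx, Instr.exec]
    rw [restrict_update hx]
    rcases hS : c.2 x with _ | ⟨b, r⟩
    · simp only [List.head?_nil, Option.isNone_none, cond_true, List.tail_nil]
      rw [stepAux_jump, ← hS, Function.update_eq_self]
    · simp only [List.head?_cons, Option.isNone_some, cond_false, List.tail_cons]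
      rw [stepAux_pushStmt _ _ _ hys, stepAux_popStmt _ _ _ hzs, stepAux_jump]
  | branch x l₀ l₁ l₂ =>
    simp only [Instr.toStmt, Turing.TM2.stepAux, val_ofNat hi, Instr.exec]
    rcases hS : c.2 x with _ | ⟨_ | _, r⟩ <;> simp [stepAux_jump]

/-- The Turing machine that runs a program. -/
def machine (m : ℕ) (code : List Instr) (l : Fin (code.length + 1)) : TMStmt m code.length :=
  match code[(l : ℕ)]? with
  | some i => i.toStmt m code.length l
  | none => .halt

theorem step_machine {code : List Instr} (hm : ∀ i ∈ code, i.Bounded m) {c : ℕ × Stacks} {i : Instr}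
    (hi : code[c.1]? = some i) :
    Turing.TM2.step (machine m code) (toCfg m code.length c) =
      some (toCfg m code.length (i.exec c)) := by
  obtain ⟨hlt, rfl⟩ := List.getElem?_eq_some_iff.1 hi
  have hv := val_ofNat (m := code.length) hlt.le
  simp only [toCfg, Turing.TM2.step, Option.some.injEq]
  rw [machine, hv, hi]
  exact stepAux_toStmt (hm _ (List.getElem_mem hlt)) c none

theorem iterate_machine {code : List Instr} (hm : ∀ i ∈ code, i.Bounded m) {n : ℕ}
    {c c' : ℕ × Stacks} (h : Runs code n c c') :
    (flip bind (Turing.TM2.step (machine m code)))^[n] (some (toCfg m code.length c)) =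
      some (toCfg m code.length c') := by
  induction h with
  | refl => rfl
  | step hi _ ih =>
    rw [Function.iterate_succ_apply]
    simpa [flip, step_machine hm hi] using ih

end Translation

/-- Functions of one string that are `PolyTime` are computed by a Turing machine in polynomial
time. -/
theorem PolyTime.nonempty_tm2 {I : Type} {e : I → List Bool} {f : List Bool → I}
    (hf : PolyTime (fun _ : Fin 1 => (id : List Bool → List Bool)) fun w => e (f w)) :
    Nonempty (Turing.TM2ComputableInPolyTime (id : List Bool → List Bool) e f) := by
  obtain ⟨len, P, hP, hf⟩ := hf
  -- Stack 1 holds the input, stack 2 collects the reversed output and stack 3 receives it in order.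
  -- All other stacks must be empty on halting, so the input is cleared too.
  obtain ⟨F, rfl, hF⟩ := hf 0 2 4 (fun _ => 1) (by simp) (by simp) (by simp)
  generalize hcode : F ++ [Instr.pop 1 [] [] F.length, Instr.pop 2 [3] [] (F.length + 1)] = code
  have hlen : code.length = F.length + 2 := by simp [← hcode]
  have hat : At code 0 (F ++ [Instr.pop 1 [] [] F.length, Instr.pop 2 [3] [] (F.length + 1)]) :=
    ⟨[], [], by simp [hcode], rfl⟩
  have hsz : ∀ w : List Bool, size (fun _ : Fin 1 => (id : List Bool → List Bool)) w = w.length :=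
    fun w => by simp [size]
  have run : ∀ w : List Bool, ∃ n ≤ 2 * P.eval w.length + w.length + 2,
      Runs code n (0, Function.update (fun _ => []) 1 w)
        (code.length, Function.update (fun _ => []) 3 (e (f w))) := by
    intro w
    obtain ⟨n, hn, r1⟩ := hF code hat.left w (Function.update (fun _ => []) 1 w) (by simp)
      (fun k hk => by simp [show k ≠ 1 by omega]) (by simp)
    have hP : (e (f w)).length ≤ _ := hP w
    rw [hsz] at hn hP
    have h1 := hat.right.get
    have h2 := hat.right.tail.get
    rw [zero_add] at h1 h2 r1
    have r2 := runs_clear h1 (Function.update (Function.update (fun _ => []) 1 w) 2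
      ((e (f w)).reverse ++ Function.update (fun _ => []) 1 w 2))
    have r3 := runs_move h2 (by simp) (Function.update
      (Function.update (Function.update (fun _ => []) 1 w) 2
        ((e (f w)).reverse ++ Function.update (fun _ => []) 1 w 2)) 1 [])
    refine ⟨_, ?_, (r1.trans (r2.trans r3)).congr rfl ?_⟩
    · simp
      omega
    · funext k
      by_cases h3 : k = 3
      · subst h3; simp
      · by_cases h2 : k = 2
        · subst h2; simp
        · by_cases h1 : k = 1
          · subst h1; simp
          · simp [h1, h2, h3]
  obtain ⟨m', hm'⟩ := exists_bounded code
  obtain ⟨m, hm, hm3⟩ : ∃ m, (∀ i ∈ code, i.Bounded m) ∧ 3 ≤ m :=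
    ⟨m' + 3, fun i hi => (hm' i hi).mono (by omega), by omega⟩
  have v1 : ((Fin.ofNat (m + 1) 1 : Fin (m + 1)) : ℕ) = 1 := val_ofNat (by omega)
  have v3 : ((Fin.ofNat (m + 1) 3 : Fin (m + 1)) : ℕ) = 3 := val_ofNat (by omega)
  let tm : Turing.FinTM2 :=
    { K := Fin (m + 1)
      k₀ := Fin.ofNat (m + 1) 1
      k₁ := Fin.ofNat (m + 1) 3
      Γ := fun _ => Bool
      Λ := Fin (code.length + 1)
      main := Fin.ofNat (code.length + 1) 0
      σ := Option Bool
      initialState := none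
      Γk₀Fin := inferInstanceAs (Fintype Bool)
      m := machine m code }
  have hinit : ∀ w : List Bool, Turing.initList tm w =
      toCfg m code.length (0, Function.update (fun _ => []) 1 w) := by
    intro w
    have : ∀ k : Fin (m + 1), (if k = Fin.ofNat (m + 1) 1 then w else []) =
        Function.update (fun _ : ℕ => ([] : List Bool)) 1 w k := by
      intro k
      rw [Function.update_apply]
      refine if_congr ?_ rfl rfl
      rw [Fin.ext_iff, v1]
    simp only [toCfg, ← this]
    rfl
  have hhalt : ∀ w : List Bool, Turing.TM2.step (machine m code)
      (toCfg m code.length (code.length, Function.update (fun _ => []) 3 w)) =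
        some (Turing.haltList tm w) := by
    intro w
    have : ∀ k : Fin (m + 1), (if k = Fin.ofNat (m + 1) 3 then w else []) =
        Function.update (fun _ : ℕ => ([] : List Bool)) 3 w k := by
      intro k
      rw [Function.update_apply]
      refine if_congr ?_ rfl rfl
      rw [Fin.ext_iff, v3]
    simp only [toCfg, ← this, Turing.TM2.step]
    rw [machine, val_ofNat le_rfl, List.getElem?_eq_none le_rfl]
    rfl
  refine ⟨{ tm := tm
            inputAlphabet := Equiv.refl Bool
            outputAlphabet := Equiv.refl Bool
            time := 2 * P + Polynomial.X + 3
            outputsFun := fun w => Classical.choice ?_ }⟩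
  obtain ⟨n, hn, hrun⟩ := run w
  -- The additional step is the halt at the address just past the program.
  refine ⟨{ steps := n + 1, evals_in_steps := ?_, steps_le_m := ?_ }⟩
  · have h1 : List.map (Equiv.refl Bool).invFun (id w) = w := List.map_id w
    have h2 : List.map (Equiv.refl Bool).invFun (e (f w)) = e (f w) := List.map_id _
    erw [h1, h2]
    rw [hinit, Function.iterate_succ_apply']
    erw [iterate_machine hm hrun]
    exact hhalt _
  · simp
    omega

end StackCode

/-! ### Token systems and the associated anonymous games -/

/-- A token system: a set of facts evolves by transitions, which are indexed by natural numbers.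
Transition `t` removes a fact in `consume₁ t` and another one in `consume₂ t`, and then adds facts
in `produce₁ t` and `produce₂ t`. -/
structure TokenSystem (F : Type) where
  consume₁ : ℕ → F → Prop
  consume₂ : ℕ → F → Prop
  produce₁ : ℕ → F → Prop
  produce₂ : ℕ → F → Prop
  /-- the facts that hold initially -/
  initial : F → Prop
  /-- the rejecting transitions -/
  reject : ℕ → Prop
  /-- two less than the number of facts that hold initially -/
  size : ℕ
  /-- the largest index of a transition -/
  maxIndex : ℕ

/-- The roles of the players in the game of a token system. -/
inductive Role (F : Type)
  | ctrl
  | pool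
  | fact (j : F)

/-- The phases of the game of a token system. -/
inductive Phase
  | reset
  | consume
  | produce

/-- The strategy of the control player in a phase. -/
def Phase.strategy : Phase → Fin 5
  | reset => 0
  | consume => 3
  | produce => 4

namespace TokenSystem

variable {F : Type} (σ : TokenSystem F)

/-- The player of fact `j` wants the fact to hold, when the transition index is `t` and `f` other
facts hold. -/
def WantOn (ph : Phase) (t f : ℕ) (j : F) : Prop :=
  ph = .produce ∧ (t = 0 ∧ f < σ.size + 2 ∧ σ.initial j ∨ f = σ.size ∧ σ.produce₁ t j ∨
    f = σ.size + 1 ∧ σ.produce₂ t j)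

/-- The player of fact `j` wants the fact not to hold. -/
def WantOff (ph : Phase) (t f : ℕ) (j : F) : Prop :=
  ph = .reset ∨ ph = .consume ∧ (f = σ.size + 1 ∧ σ.consume₁ t j ∨ f = σ.size ∧ σ.consume₂ t j)

/-- The pool players want to increase the transition index. -/
def WantUp (ph : Phase) (f : ℕ) : Prop :=
  ph = .consume ∧ f = σ.size + 2

/-- The pool players want to decrease the transition index. -/
def WantDown (ph : Phase) (f : ℕ) : Prop :=
  ph = .reset ∨ ph = .produce ∧ f = σ.size + 2

open Classical in
/-- The utility of the control player in the phases. -/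
noncomputable def rank (t f : ℕ) : Phase → ℤ
  | .reset => if f = 0 ∧ t = 0 then 2 else 3
  | .consume => if f = σ.size + 2 ∧ t = 0 then 2 else if f = σ.size ∧ σ.reject t then 3 else 1
  | .produce => if f = 0 ∧ t = 0 then 3 else if f = σ.size then 2 else 1

/-- The phase, as seen by the players other than the control player. -/
def phaseOf (c : Fin 5 → ℕ) : Phase :=
  if 0 < c 3 then .consume else if 0 < c 4 then .produce else .reset

open Classical in
/-- The utilities of the game of a token system. Strategy `1` is for facts that hold, `2` is for
pool players that are counted in the transition index, `3` and `4` are phases of the control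
player, and `0` is the default strategy. -/
noncomputable def utility : Role F → Fin 5 → (Fin 5 → ℕ) → ℤ
  | .ctrl, a, c => if a = 0 then σ.rank (c 2) (c 1) .reset else
      if a = 3 then σ.rank (c 2) (c 1) .consume else
      if a = 4 then σ.rank (c 2) (c 1) .produce else 0
  | .pool, a, c => if a = 0 then (if σ.WantDown (phaseOf c) (c 1) then 2 else 1) else
      if a = 2 then (if σ.WantUp (phaseOf c) (c 1) then 2 else 1) else 0
  | .fact j, a, c => if a = 0 then (if σ.WantOff (phaseOf c) (c 2) (c 1) j then 2 else 1) else
      if a = 1 then (if σ.WantOn (phaseOf c) (c 2) (c 1) j then 2 else 1) else 0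

/-- The game of a token system, for players with given roles. -/
noncomputable def game {n : ℕ} (role : Fin n → Role F) : AnonymousGame where
  numPlayers := n
  numStrategies := 5
  utility i a c := σ.utility (role i) a c.1

/-- Transition `t` can consume `a` and `b`. -/
structure Fires [DecidableEq F] (O : Finset F) (t : ℕ) (a b : F) : Prop where
  le : t ≤ σ.maxIndex
  mem₁ : a ∈ O
  mem₂ : b ∈ O.erase a
  consume₁ : σ.consume₁ t a
  consume₂ : σ.consume₂ t b

variable [DecidableEq F] (facts : Finset F)

/-- One step of a token system with the given set of facts. -/
def Step (O O' : Finset F) : Prop :=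
  ∃ t a b c d, σ.Fires O t a b ∧ c ∈ facts ∧ c ∉ (O.erase a).erase b ∧ σ.produce₁ t c ∧
    d ∈ facts ∧ d ∉ insert c ((O.erase a).erase b) ∧ σ.produce₂ t d ∧
    O' = insert d (insert c ((O.erase a).erase b))

/-- A state of the game up to the names of the pool players: the phase, the transition index and
the set of facts that hold. -/
structure AbstractState (F : Type) where
  phase : Phase
  index : ℕ
  on : Finset F

/-- The arcs of the state graph in terms of abstract states. -/
inductive AbstractArc : AbstractState F → AbstractState F → Prop
  | on {ph t O j} : j ∈ facts → j ∉ O → σ.WantOn ph t O.card j →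
      AbstractArc ⟨ph, t, O⟩ ⟨ph, t, insert j O⟩
  | off {ph t O j f} : j ∈ O → O.card = f + 1 → σ.WantOff ph t f j →
      AbstractArc ⟨ph, t, O⟩ ⟨ph, t, O.erase j⟩
  | up {ph t O} : t < σ.maxIndex → σ.WantUp ph O.card → AbstractArc ⟨ph, t, O⟩ ⟨ph, t + 1, O⟩
  | down {ph t O} : σ.WantDown ph O.card → AbstractArc ⟨ph, t + 1, O⟩ ⟨ph, t, O⟩
  | phase {ph ph' t O} : σ.rank t O.card ph < σ.rank t O.card ph' →
      AbstractArc ⟨ph, t, O⟩ ⟨ph', t, O⟩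

/-- Reachability in the abstract state graph. -/
def AbstractReach : AbstractState F → AbstractState F → Prop :=
  Relation.ReflTransGen (σ.AbstractArc facts)

open Classical in
/-- The set of facts that hold initially. -/
noncomputable def initialSet : Finset F :=
  {j ∈ facts | σ.initial j}

/-- Assumptions on the indices of transitions and on the initial facts. -/
structure Regular : Prop where
  card_initialSet : (σ.initialSet facts).card = σ.size + 2
  not_consume₁ : ∀ j, ¬σ.consume₁ 0 j
  not_produce₁ : ∀ j, ¬σ.produce₁ 0 j
  not_produce₂ : ∀ j, ¬σ.produce₂ 0 j
  not_reject : ¬σ.reject 0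

/-- The abstract state in which the simulation starts. -/
noncomputable def start : AbstractState F :=
  ⟨.consume, 0, σ.initialSet facts⟩

/-- Reachability in the token system from the initial set of facts. -/
def Reaches (O : Finset F) : Prop :=
  Relation.ReflTransGen (σ.Step facts) (σ.initialSet facts) O

/-! ### Reachability among abstract states. -/

variable {σ facts}

omit [DecidableEq F] in
theorem mem_initialSet {j : F} : j ∈ σ.initialSet facts ↔ j ∈ facts ∧ σ.initial j := by
  classical
  rw [initialSet, Finset.mem_filter]

theorem Fires.card_erase {O : Finset F} {t : ℕ} {a b : F} (h : σ.Fires O t a b)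
    (hO : O.card = σ.size + 2) : ((O.erase a).erase b).card = σ.size := by
  rw [Finset.card_erase_of_mem h.mem₂, Finset.card_erase_of_mem h.mem₁, hO]
  rfl

theorem Reaches.card (hσ : σ.Regular facts) {O : Finset F} (h : σ.Reaches facts O) :
    O.card = σ.size + 2 := by
  induction h with
  | refl => exact hσ.card_initialSet
  | tail _ h ih =>
    obtain ⟨t, a, b, c, d, hf, _, hc, _, _, hd, _, rfl⟩ := h
    rw [Finset.card_insert_of_notMem hd, Finset.card_insert_of_notMem hc, hf.card_erase ih]

theorem Fires.pos (hσ : σ.Regular facts) {O : Finset F} {t : ℕ} {a b : F} (h : σ.Fires O t a b) :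
    t ≠ 0 := by
  rintro rfl
  exact hσ.not_consume₁ _ h.consume₁

theorem reach_index_down {ph : Phase} {t : ℕ} {O : Finset F} (h : σ.WantDown ph O.card) :
    σ.AbstractReach facts ⟨ph, t, O⟩ ⟨ph, 0, O⟩ := by
  induction t with
  | zero => exact .refl
  | succ t ih => exact .head (.down h) ih

theorem reach_index_up {O : Finset F} (h : O.card = σ.size + 2) {t : ℕ} (ht : t ≤ σ.maxIndex) :
    σ.AbstractReach facts ⟨.consume, 0, O⟩ ⟨.consume, t, O⟩ := by
  induction t with
  | zero => exact .refl
  | succ t ih => exact .tail (ih (by omega)) (.up (by omega) ⟨rfl, h⟩)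

theorem reach_empty {t : ℕ} (O : Finset F) :
    σ.AbstractReach facts ⟨.reset, t, O⟩ ⟨.reset, t, ∅⟩ := by
  induction O using Finset.induction_on with
  | empty => exact .refl
  | insert j O hj ih =>
    refine .head ?_ ih
    have := AbstractArc.off (σ := σ) (facts := facts) (ph := .reset) (t := t)
      (Finset.mem_insert_self j O) (Finset.card_insert_of_notMem hj) (.inl rfl)
    rwa [Finset.erase_insert hj] at this

/-- With index 0 the missing initial facts enter one at a time. Once all `size + 2` hold, `consume`
has rank 2 against 1 for `produce`. -/
theorem reach_start_of_produce (hσ : σ.Regular facts) {O : Finset F} (h : O ⊆ σ.initialSet facts) :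
    σ.AbstractReach facts ⟨.produce, 0, O⟩ (σ.start facts) := by
  induction hn : (σ.initialSet facts \ O).card generalizing O with
  | zero =>
    have : O = σ.initialSet facts :=
      h.antisymm (Finset.sdiff_eq_empty_iff_subset.1 (Finset.card_eq_zero.1 hn))
    subst this
    refine .single (.phase ?_)
    simp [rank, hσ.card_initialSet]
  | succ n ih =>
    obtain ⟨j, hj⟩ : (σ.initialSet facts \ O).Nonempty := by
      rw [← Finset.card_pos]
      omega
    obtain ⟨hj, hjO⟩ := Finset.mem_sdiff.1 hj
    have hins : insert j O ⊆ σ.initialSet facts := Finset.insert_subset hj h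
    have hcard : O.card < σ.size + 2 := by
      have := Finset.card_le_card hins
      rw [Finset.card_insert_of_notMem hjO, hσ.card_initialSet] at this
      omega
    have hj' := hj
    rw [mem_initialSet] at hj'
    refine .head (.on hj'.1 hjO ⟨rfl, .inl ⟨rfl, hcard, hj'.2⟩⟩) (ih hins ?_)
    rw [Finset.sdiff_insert, Finset.card_erase_of_mem (Finset.mem_sdiff.2 ⟨hj, hjO⟩), hn]
    rfl

/-- Counter and facts are cleared; only when both are zero does `reset` drop to rank 2, below the 3
of `produce`. -/
theorem reach_start_of_reset (hσ : σ.Regular facts) {t : ℕ} {O : Finset F} :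
    σ.AbstractReach facts ⟨.reset, t, O⟩ (σ.start facts) := by
  refine ((reach_index_down (.inl rfl)).trans (reach_empty O)).trans
    (.head (.phase (ph' := .produce) ?_) (reach_start_of_produce hσ (by simp)))
  simp [rank]

/-- Fact players do not count themselves: the first consumed fact sees `size + 1` others, and the
second sees `size` after the first has left. This enforces the order of removal. -/
theorem reach_consumed {O : Finset F} (hO : O.card = σ.size + 2) {t : ℕ} {a b : F}
    (h : σ.Fires O t a b) :
    σ.AbstractReach facts ⟨.consume, 0, O⟩ ⟨.consume, t, (O.erase a).erase b⟩ := by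
  have h1 : (O.erase a).card = σ.size + 1 := by
    rw [Finset.card_erase_of_mem h.mem₁, hO]
    rfl
  refine (reach_index_up hO h.le).trans (.head (.off h.mem₁ hO ?_) (.single (.off h.mem₂ h1 ?_)))
  · exact .inr ⟨rfl, .inl ⟨rfl, h.consume₁⟩⟩
  · exact .inr ⟨rfl, .inr ⟨rfl, h.consume₂⟩⟩

/-- One round through `consume` and `produce` performs one transition. By `hd` its index is not
rejecting, as otherwise the control player would stay in `consume`. -/
theorem reach_of_step (hσ : σ.Regular facts)
    (hd : ∀ t c, σ.produce₁ t c → ¬σ.reject t) {O O' : Finset F} (hO : O.card = σ.size + 2)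
    (h : σ.Step facts O O') :
    σ.AbstractReach facts ⟨.consume, 0, O⟩ ⟨.consume, 0, O'⟩ := by
  obtain ⟨t, a, b, c, d, hf, hc, hc', hct, hd1, hd', hdt, rfl⟩ := h
  have h2 := hf.card_erase hO
  have ht := hf.pos hσ
  have h3 := (Finset.card_insert_of_notMem hc').trans (congrArg (· + 1) h2)
  have h4 := (Finset.card_insert_of_notMem hd').trans (congrArg (· + 1) h3)
  refine (reach_consumed hO hf).trans (.head (.phase (ph' := .produce) ?_)
    (.head (.on hc hc' ⟨rfl, .inr (.inl ⟨h2, hct⟩)⟩)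
    (.head (.on hd1 hd' ⟨rfl, .inr (.inr ⟨h3, hdt⟩)⟩)
    ((reach_index_down (.inr ⟨rfl, h4⟩)).tail (.phase ?_)))))
  · simp [rank, h2, ht, hd t c hct]
  · simp [rank, h4, show σ.size + 1 + 1 ≠ σ.size by omega]

theorem reach_of_reaches (hσ : σ.Regular facts) (hd : ∀ t c, σ.produce₁ t c → ¬σ.reject t)
    {O : Finset F} (h : σ.Reaches facts O) :
    σ.AbstractReach facts (σ.start facts) ⟨.consume, 0, O⟩ := by
  induction h with
  | refl => exact .refl
  | tail h h' ih => exact ih.trans (reach_of_step hσ hd (Reaches.card hσ h) h')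

/-- Here `consume` has rank 3, the largest value of `rank`. With `size` facts present, a fact that
holds sees too few others to leave, and the pool players would need `size + 2` facts to move. -/
theorem stuck_of_reject {t : ℕ} {O : Finset F} (hσ : σ.Regular facts) (hO : O.card = σ.size)
    (ht : σ.reject t) (x : AbstractState F) : ¬σ.AbstractArc facts ⟨.consume, t, O⟩ x := by
  have ht0 : t ≠ 0 := by
    rintro rfl
    exact hσ.not_reject ht
  intro h
  cases h with
  | on _ _ h => exact absurd h.1 (by simp)
  | off _ h1 h =>
    rcases h with h | ⟨_, h | h⟩
    · simp at h
    · omega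
    · omega
  | up _ h => have := h.2; omega
  | down h =>
    rcases h with h | h
    · simp at h
    · simp at h
  | @phase _ ph' _ _ h =>
    cases ph' <;> simp only [rank, hO, ht0, ht] at h <;> simp at h

/-- Outside `reset`, moving to `reset` is an improvement with two exceptions: `produce` with no
facts and index 0, which leads to the start directly, and the rejecting deadlock. -/
theorem reach_start_or_stuck (hσ : σ.Regular facts) (x : AbstractState F) :
    ∃ y, σ.AbstractReach facts x y ∧ (y = σ.start facts ∨ ∀ z, ¬σ.AbstractArc facts y z) := by
  obtain ⟨ph, t, O⟩ := x
  cases ph with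
  | reset => exact ⟨_, reach_start_of_reset hσ, .inl rfl⟩
  | produce =>
    by_cases h : O.card = 0 ∧ t = 0
    · obtain ⟨h1, rfl⟩ := h
      rw [Finset.card_eq_zero] at h1
      subst h1
      exact ⟨_, reach_start_of_produce hσ (by simp), .inl rfl⟩
    · refine ⟨_, .head (.phase (ph' := .reset) ?_) (reach_start_of_reset hσ), .inl rfl⟩
      simp only [rank, if_neg h]
      split <;> simp
  | consume =>
    by_cases h : O.card = σ.size ∧ σ.reject t
    · exact ⟨_, .refl, .inr (stuck_of_reject hσ h.1 h.2)⟩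
    · refine ⟨_, .head (.phase (ph' := .reset) ?_) (reach_start_of_reset hσ), .inl rfl⟩
      simp only [rank, if_neg h]
      split_ifs <;> omega

theorem exists_reach_stuck (hσ : σ.Regular facts) (hd : ∀ t c, σ.produce₁ t c → ¬σ.reject t)
    {O : Finset F} {t : ℕ} {a b : F} (hO : σ.Reaches facts O) (hf : σ.Fires O t a b)
    (ht : σ.reject t) (x : AbstractState F) :
    ∃ y, σ.AbstractReach facts x y ∧ ∀ z, ¬σ.AbstractArc facts y z := by
  obtain ⟨y, hxy, rfl | hy⟩ := reach_start_or_stuck hσ x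
  · exact ⟨_, (hxy.trans (reach_of_reaches hσ hd hO)).trans
      (reach_consumed (Reaches.card hσ hO) hf),
      stuck_of_reject hσ (hf.card_erase (Reaches.card hσ hO)) ht⟩
  · exact ⟨y, hxy, hy⟩

variable (σ facts) in
/-- The abstract states that occur in the simulation. -/
inductive Simulating : AbstractState F → Prop
  | reset {t O} : t ≤ σ.maxIndex → Simulating ⟨.reset, t, O⟩
  | consume {t O} : t ≤ σ.maxIndex → σ.Reaches facts O → Simulating ⟨.consume, t, O⟩
  | consumed₁ {t O a} : t ≤ σ.maxIndex → σ.Reaches facts O → a ∈ O → σ.consume₁ t a →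
      Simulating ⟨.consume, t, O.erase a⟩
  | consumed₂ {t O a b} : σ.Reaches facts O → σ.Fires O t a b →
      Simulating ⟨.consume, t, (O.erase a).erase b⟩
  | init {O} : O ⊆ σ.initialSet facts → Simulating ⟨.produce, 0, O⟩
  | produce {t O a b} : σ.Reaches facts O → σ.Fires O t a b →
      Simulating ⟨.produce, t, (O.erase a).erase b⟩
  | produced₁ {t O a b c} : σ.Reaches facts O → σ.Fires O t a b → c ∈ facts →
      c ∉ (O.erase a).erase b → σ.produce₁ t c →
      Simulating ⟨.produce, t, insert c ((O.erase a).erase b)⟩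
  | produced₂ {t O} : t ≤ σ.maxIndex → σ.Reaches facts O → Simulating ⟨.produce, t, O⟩

/-- The number of facts fixes the stage of the current transition, so only the facts meant for that
stage can move, and besides `reset` the control player can only take the phase that comes next. Here
`hrej` rules out a return from `produce` to `consume` at a rejecting index. -/
theorem Simulating.arc (hσ : σ.Regular facts)
    (hrej : ∀ O t a b, σ.Reaches facts O → σ.Fires O t a b → ¬σ.reject t)
    {x y : AbstractState F} (hx : σ.Simulating facts x) (h : σ.AbstractArc facts x y) :
    σ.Simulating facts y := by
  cases hx with
  | @reset t O ht =>
    cases h with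
    | on _ _ h => exact absurd h.1 (by simp)
    | off => exact .reset ht
    | up _ h => exact absurd h.1 (by simp)
    | down => exact .reset (by omega)
    | @phase _ ph' _ _ h =>
      cases ph' with
      | reset => exact .reset ht
      | consume =>
        by_cases h0 : O.card = 0 ∧ t = 0
        · have h1 : ¬(O.card = σ.size + 2 ∧ t = 0) := by omega
          have h2 : ¬(O.card = σ.size ∧ σ.reject t) := by
            rw [h0.2]
            exact fun h => hσ.not_reject h.2
          simp only [rank, if_pos h0, if_neg h1, if_neg h2] at h
          simp at h
        · simp only [rank, if_neg h0] at h
          split_ifs at h <;> simp at h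
      | produce =>
        by_cases h0 : O.card = 0 ∧ t = 0
        · obtain ⟨h1, rfl⟩ := h0
          rw [Finset.card_eq_zero] at h1
          subst h1
          exact .init (by simp)
        · simp only [rank, if_neg h0] at h
          split_ifs at h <;> simp at h
  | @consume t O ht hO =>
    have hc := Reaches.card hσ hO
    cases h with
    | on _ _ h => exact absurd h.1 (by simp)
    | off hj hcard h =>
      rcases h with h | ⟨_, h | h⟩
      · simp at h
      · exact .consumed₁ ht hO hj h.2
      · omega
    | up ht' _ => exact .consume ht' hO
    | down h => rcases h with h | h <;> simp at h
    | @phase _ ph' _ _ h =>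
      cases ph' with
      | reset => exact .reset ht
      | consume => exact .consume ht hO
      | produce =>
        have h1 : ¬(O.card = 0 ∧ t = 0) := by omega
        have h2 : O.card ≠ σ.size := by omega
        simp only [rank, if_neg h1, if_neg h2] at h
        split_ifs at h <;> simp at h
  | @consumed₁ t O a ht hO ha hta =>
    have hc : (O.erase a).card = σ.size + 1 := by
      rw [Finset.card_erase_of_mem ha, Reaches.card hσ hO]
      rfl
    cases h with
    | on _ _ h => exact absurd h.1 (by simp)
    | off hj hcard h =>
      rcases h with h | ⟨_, h | h⟩
      · simp at h
      · omega
      · exact .consumed₂ hO ⟨ht, ha, hj, hta, h.2⟩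
    | up _ h => have := h.2; omega
    | down h => rcases h with h | h <;> simp at h
    | @phase _ ph' _ _ h =>
      cases ph' with
      | reset => exact .reset ht
      | consume => exact .consumed₁ ht hO ha hta
      | produce => simp [rank, hc] at h
  | @consumed₂ t O a b hO hf =>
    have hc := hf.card_erase (Reaches.card hσ hO)
    have ht := hf.pos hσ
    cases h with
    | on _ _ h => exact absurd h.1 (by simp)
    | off hj hcard h =>
      rcases h with h | ⟨_, h | h⟩
      · simp at h
      · omega
      · omega
    | up _ h => have := h.2; omega
    | down h => rcases h with h | h <;> simp at h
    | @phase _ ph' _ _ h =>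
      cases ph' with
      | reset => exact .reset hf.le
      | consume => exact .consumed₂ hO hf
      | produce => exact .produce hO hf
  | @init O hO =>
    have hc := Finset.card_le_card hO
    rw [hσ.card_initialSet] at hc
    cases h with
    | on hj hjO h =>
      rcases h.2 with h | h | h
      · refine .init (Finset.insert_subset ?_ hO)
        rw [mem_initialSet]
        exact ⟨hj, h.2.2⟩
      · exact absurd h.2 (hσ.not_produce₁ _)
      · exact absurd h.2 (hσ.not_produce₂ _)
    | off hj hcard h => rcases h with h | h <;> simp at h
    | up _ h => exact absurd h.1 (by simp)
    | @phase _ ph' _ _ h =>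
      cases ph' with
      | reset => exact .reset (Nat.zero_le _)
      | consume =>
        -- Leaving `produce` for `consume` at index 0 requires rank 2 in `consume`, hence `size + 2`
        -- facts.
        have h1 : O = σ.initialSet facts := by
          by_contra hne
          have h1 : O.card ≠ σ.size + 2 := fun h1 =>
            hne (Finset.eq_of_subset_of_card_le hO (by rw [hσ.card_initialSet, h1]))
          simp only [rank, hσ.not_reject, h1] at h
          split_ifs at h <;> simp at *
        rw [h1]
        exact .consume (Nat.zero_le _) .refl
      | produce => exact .init hO
  | @produce t O a b hO hf =>
    have hc := hf.card_erase (Reaches.card hσ hO)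
    have ht := hf.pos hσ
    cases h with
    | on hj hjO h =>
      rcases h.2 with h | h | h
      · exact absurd h.1 ht
      · exact .produced₁ hO hf hj hjO h.2
      · omega
    | off hj hcard h => rcases h with h | h <;> simp at h
    | up _ h => exact absurd h.1 (by simp)
    | down h =>
      rcases h with h | h
      · simp at h
      · omega
    | @phase _ ph' _ _ h =>
      cases ph' with
      | reset => exact .reset hf.le
      | consume => simp [rank, hc, ht, hrej _ _ _ _ hO hf] at h
      | produce => exact .produce hO hf
  | @produced₁ t O a b c hO hf hcf hcO hct =>
    have hc := (Finset.card_insert_of_notMem hcO).trans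
      (congrArg (· + 1) (hf.card_erase (Reaches.card hσ hO)))
    have ht := hf.pos hσ
    cases h with
    | on hj hjO h =>
      rcases h.2 with h | h | h
      · exact absurd h.1 ht
      · omega
      · exact .produced₂ hf.le (.tail hO ⟨t, a, b, c, _, hf, hcf, hcO, hct, hj, hjO, h.2, rfl⟩)
    | off hj hcard h => rcases h with h | h <;> simp at h
    | up _ h => exact absurd h.1 (by simp)
    | down h =>
      rcases h with h | h
      · simp at h
      · omega
    | @phase _ ph' _ _ h =>
      cases ph' with
      | reset => exact .reset hf.le
      | consume => simp [rank, hc] at h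
      | produce => exact .produced₁ hO hf hcf hcO hct
  | @produced₂ t O ht hO =>
    have hc := Reaches.card hσ hO
    cases h with
    | on hj hjO h => rcases h.2 with h | h | h <;> omega
    | off hj hcard h => rcases h with h | h <;> simp at h
    | up _ h => exact absurd h.1 (by simp)
    | down h => exact .produced₂ (by omega) hO
    | @phase _ ph' _ _ h =>
      cases ph' with
      | reset => exact .reset ht
      | consume => exact .consume ht hO
      | produce => exact .produced₂ ht hO

/-- In `consume` and `produce`, `reset` is a strict improvement except while the initial facts are
entering, where completing them leads to the start. The deadlock is excluded by `hrej`. -/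
theorem Simulating.reach_start (hσ : σ.Regular facts)
    (hrej : ∀ O t a b, σ.Reaches facts O → σ.Fires O t a b → ¬σ.reject t)
    {x : AbstractState F} (hx : σ.Simulating facts x) :
    σ.AbstractReach facts x (σ.start facts) := by
  cases hx with
  | reset => exact reach_start_of_reset hσ
  | @consume t O ht hO =>
    refine .head (.phase (ph' := .reset) ?_) (reach_start_of_reset hσ)
    have hc := Reaches.card hσ hO
    have h0 : ¬(O.card = 0 ∧ t = 0) := by omega
    have h1 : ¬(O.card = σ.size ∧ σ.reject t) := fun h => by omega
    simp only [rank, if_neg h0, if_neg h1]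
    split_ifs <;> simp
  | consumed₁ ht hO ha hta =>
    refine .head (.phase (ph' := .reset) ?_) (reach_start_of_reset hσ)
    simp [rank, Finset.card_erase_of_mem ha, Reaches.card hσ hO]
  | consumed₂ hO hf =>
    refine .head (.phase (ph' := .reset) ?_) (reach_start_of_reset hσ)
    simp [rank, hf.card_erase (Reaches.card hσ hO), hf.pos hσ, hrej _ _ _ _ hO hf]
  | init hO => exact reach_start_of_produce hσ hO
  | produce hO hf =>
    refine .head (.phase (ph' := .reset) ?_) (reach_start_of_reset hσ)
    simp [rank, hf.card_erase (Reaches.card hσ hO), hf.pos hσ]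
  | produced₁ hO hf _ hcO _ =>
    refine .head (.phase (ph' := .reset) ?_) (reach_start_of_reset hσ)
    simp [rank, Finset.card_insert_of_notMem hcO, hf.card_erase (Reaches.card hσ hO), hf.pos hσ]
  | produced₂ ht hO =>
    refine .head (.phase (ph' := .reset) ?_) (reach_start_of_reset hσ)
    simp [rank, Reaches.card hσ hO]

end TokenSystem

/-! ### Arcs of anonymous games and criteria for non-singleton sinks. -/

theorem AnonymousGame.arc_iff (G : AnonymousGame) (s t : Fin G.numPlayers → Fin G.numStrategies) :
    G.toStrategicGame.Arc s t ↔ ∃ i a, t = Function.update s i a ∧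
      G.utility i (s i) (othersPartition s i) < G.utility i a (othersPartition s i) := by
  -- A deviation of `i` does not change the counts that `i` sees, so both utilities are taken at the
  -- same partition.
  have h : ∀ i a, othersPartition (Function.update s i a) i = othersPartition s i := by
    intro i a
    refine Subtype.ext (funext fun b => ?_)
    show (Finset.univ.filter fun j => j ≠ i ∧ Function.update s i a j = b).card =
      (Finset.univ.filter fun j => j ≠ i ∧ s j = b).card
    refine congrArg Finset.card (Finset.filter_congr fun j _ => ?_)
    refine and_congr_right fun hj => ?_
    rw [Function.update_of_ne hj]
  constructor
  · rintro ⟨i, a, rfl, hlt⟩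
    refine ⟨i, a, rfl, ?_⟩
    simpa only [toStrategicGame, Int.cast_lt, h, Function.update_self] using hlt
  · rintro ⟨i, a, rfl, hlt⟩
    refine ⟨i, a, rfl, ?_⟩
    simpa only [toStrategicGame, Int.cast_lt, h, Function.update_self] using hlt

theorem othersPartition_add {n k : ℕ} (s : Fin n → Fin k) (i : Fin n) (a : Fin k) :
    (othersPartition s i).1 a + (if s i = a then 1 else 0) =
      (Finset.univ.filter fun j => s j = a).card := by
  have h : (Finset.univ.filter fun j => j ≠ i ∧ s j = a) =
      (Finset.univ.filter fun j => s j = a).erase i := by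
    ext j
    simp
  show (Finset.univ.filter fun j => j ≠ i ∧ s j = a).card + _ = _
  rw [h]
  split_ifs with hi
  · exact Finset.card_erase_add_one (by simpa using hi)
  · rw [Finset.erase_eq_of_notMem (by simpa using hi), add_zero]

namespace StrategicGame

variable {N : Type*} {S : N → Type*} [DecidableEq N] {G : StrategicGame N S}

theorem IsSinkEquilibrium.mem_of_reach {T : Set (∀ i, S i)} (hT : G.IsSinkEquilibrium T)
    {s t : ∀ i, S i} (hs : s ∈ T) (h : G.Reach s t) : t ∈ T := by
  induction h with
  | refl => exact hs
  | tail _ h ih => exact hT.2 _ ih _ h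

/-- A sink contains whatever is reachable from it, hence a vertex without outgoing arcs, and such a
vertex forms a strongly connected component by itself. -/
theorem not_hasNonSingletonSink (h : ∀ s, ∃ t, G.Reach s t ∧ ∀ t', ¬G.Arc t t') :
    ¬G.HasNonSingletonSink := by
  rintro ⟨T, hT, hn⟩
  obtain ⟨s, hs⟩ := hn.nonempty
  obtain ⟨t, hst, ht⟩ := h s
  have htT := hT.mem_of_reach hs hst
  obtain ⟨t', ht', hne⟩ := hn.exists_ne t
  obtain ⟨⟨r, rfl⟩, _⟩ := hT
  have hr : G.Reach t t' := htT.2.trans ht'.1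
  rcases Relation.ReflTransGen.cases_head hr with rfl | ⟨_, h, _⟩
  · exact hne rfl
  · exact ht _ h

theorem hasNonSingletonSink_of_recurrent {s t : ∀ i, S i} (hst : G.Arc s t) (hne : t ≠ s)
    (h : ∀ r, G.Reach s r → G.Reach r s) : G.HasNonSingletonSink :=
  ⟨{r | G.Reach s r ∧ G.Reach r s}, ⟨⟨s, rfl⟩, fun _ hr _ hr' =>
    ⟨hr.1.tail hr', h _ (hr.1.tail hr')⟩⟩,
    s, ⟨.refl, .refl⟩, t, ⟨.single hst, h _ (.single hst)⟩, hne.symm⟩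

end StrategicGame

/-! ### Strategy profiles versus abstract states. -/

namespace TokenSystem

theorem _root_.Phase.strategy_ne (ph : Phase) : ph.strategy ≠ 1 ∧ ph.strategy ≠ 2 := by
  cases ph <;> simp [Phase.strategy]

variable {F : Type} (σ : TokenSystem F) (facts : Finset F) {n : ℕ}
  (role : Fin n → Role F)

/-- There are exactly one control player `x`, exactly one player for every fact, and the right
number of pool players. -/
structure IsRoster (x : Fin n) : Prop where
  ctrl_iff : ∀ i, role i = .ctrl ↔ i = x
  -- Quantifying over `P` avoids a decidability instance for `role i = .pool`.
  card_pool : ∀ P : Finset (Fin n), (∀ i, i ∈ P ↔ role i = .pool) → P.card = σ.maxIndex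
  fact_inj : ∀ i i' j, role i = .fact j → role i' = .fact j → i = i'
  mem_iff : ∀ j, j ∈ facts ↔ ∃ i, role i = .fact j

variable {σ facts role} {x : Fin n}

theorem IsRoster.role_ctrl (hr : σ.IsRoster facts role x) : role x = .ctrl :=
  (hr.ctrl_iff x).2 rfl

theorem utility_ctrl_strategy (c : Fin 5 → ℕ) (ph : Phase) :
    σ.utility .ctrl ph.strategy c = σ.rank (c 2) (c 1) ph := by
  cases ph <;> simp [utility, Phase.strategy]

theorem rank_pos (t f : ℕ) (ph : Phase) : 0 < σ.rank t f ph := by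
  cases ph <;> simp only [rank] <;> split_ifs <;> simp

/-- Strategies foreign to a role have utility 0, so a player on one of them improves by moving to
strategy 0. -/
theorem utility_zero_pos (ρ : Role F) (c : Fin 5 → ℕ) : 0 < σ.utility ρ 0 c := by
  cases ρ
  · simpa [utility] using rank_pos _ _ _
  all_goals
    simp only [utility, if_true]
    split_ifs <;> simp

variable [DecidableEq F]

variable (facts) in
/-- The state `s` of the game is described by an abstract state. -/
structure Represents (x : Fin n) (s : Fin n → Fin 5) (y : AbstractState F) : Prop where
  ctrl : s x = y.phase.strategy
  pool : ∀ i, role i = .pool → s i = 0 ∨ s i = 2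
  fact : ∀ i j, role i = .fact j → s i = if j ∈ y.on then 1 else 0
  subset : y.on ⊆ facts
  card : (Finset.univ.filter fun i => s i = 2).card = y.index

theorem Represents.eq_two (hr : σ.IsRoster facts role x) {s : Fin n → Fin 5} {y : AbstractState F}
    (h : Represents facts (role := role) x s y) {i : Fin n} (hi : s i = 2) : role i = .pool := by
  rcases hi' : role i with _ | _ | j
  · rw [hr.ctrl_iff] at hi'
    rw [hi', h.ctrl] at hi
    exact absurd hi (Phase.strategy_ne _).2
  · rfl
  · rw [h.fact i j hi'] at hi
    split_ifs at hi <;> exact absurd hi (by decide)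

theorem Represents.eq_one (hr : σ.IsRoster facts role x) {s : Fin n → Fin 5} {y : AbstractState F}
    (h : Represents facts (role := role) x s y) {i : Fin n} (hi : s i = 1) :
    ∃ j, role i = .fact j ∧ j ∈ y.on := by
  rcases hi' : role i with _ | _ | j
  · rw [hr.ctrl_iff] at hi'
    rw [hi', h.ctrl] at hi
    exact absurd hi (Phase.strategy_ne _).1
  · rcases h.pool i hi' with h | h <;> simp [h] at hi
  · rw [h.fact i j hi'] at hi
    split_ifs at hi with hj
    · exact ⟨j, rfl, hj⟩
    · exact absurd hi (by decide)

theorem Represents.eq_ctrl (hr : σ.IsRoster facts role x) {s : Fin n → Fin 5} {y : AbstractState F}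
    (h : Represents facts (role := role) x s y) {i : Fin n} (hi : 2 < s i) : i = x := by
  rcases hi' : role i with _ | _ | j
  · rwa [hr.ctrl_iff] at hi'
  · rcases h.pool i hi' with h | h <;> simp [h] at hi
  · rw [h.fact i j hi'] at hi
    split_ifs at hi <;> exact absurd hi (by decide)

theorem Represents.card_on (hr : σ.IsRoster facts role x) {s : Fin n → Fin 5} {y : AbstractState F}
    (h : Represents facts (role := role) x s y) :
    (Finset.univ.filter fun i => s i = 1).card = y.on.card := by
  have : Nonempty (Fin n) := ⟨x⟩
  choose! f hf using fun j => (hr.mem_iff j).1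
  symm
  refine Finset.card_bij (fun j _ => f j) ?_ ?_ ?_
  · intro j hj
    simp [h.fact _ j (hf j (h.subset hj)), hj]
  · intro j hj j' hj' he
    have h1 := hf j (h.subset hj)
    have h2 := hf j' (h.subset hj')
    rw [show f j = f j' from he, h2] at h1
    simpa using h1.symm
  · intro i hi
    obtain ⟨j, hj, hjO⟩ := h.eq_one hr (by simpa using hi)
    exact ⟨j, hjO, hr.fact_inj _ _ _ (hf j (h.subset hjO)) hj⟩

/-- Only the control player uses strategies 3 and 4, so everybody else can read off the phase from
the counts. -/
theorem Represents.phaseOf (hr : σ.IsRoster facts role x) {s : Fin n → Fin 5}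
    {y : AbstractState F} (h : Represents facts (role := role) x s y) {i : Fin n} (hi : i ≠ x) :
    phaseOf (othersPartition s i).1 = y.phase := by
  have key : ∀ a : Fin 5, 2 < a → (0 < (othersPartition s i).1 a ↔ s x = a) := by
    intro a ha
    show 0 < (Finset.univ.filter fun j => j ≠ i ∧ s j = a).card ↔ _
    rw [Finset.card_pos]
    constructor
    · rintro ⟨j, hj⟩
      simp only [Finset.mem_filter, Finset.mem_univ, true_and] at hj
      rw [← hj.2]
      congr 1
      exact (h.eq_ctrl hr (by rw [hj.2]; exact ha)).symm
    · intro hx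
      exact ⟨x, by simp [hx, hi.symm]⟩
  simp only [TokenSystem.phaseOf, key 3 (by simp), key 4 (by simp), h.ctrl]
  generalize y.phase = ph
  cases ph <;> simp [Phase.strategy]

section Update

variable {s : Fin n → Fin 5} {ph : Phase} {t : ℕ} {O : Finset F}

theorem filter_update_of_ne {i : Fin n} {a b : Fin 5} (h1 : s i ≠ b) (h2 : a ≠ b) :
    (Finset.univ.filter fun k => Function.update s i a k = b) =
      Finset.univ.filter fun k => s k = b := by
  ext k
  by_cases hk : k = i
  · subst hk; simp [h1, h2]
  · simp [hk]

theorem Represents.update_fact (hr : σ.IsRoster facts role x)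
    (h : Represents facts (role := role) x s ⟨ph, t, O⟩) {i : Fin n} {j : F}
    (hi : role i = .fact j) {O' : Finset F} (hO' : O' ⊆ facts)
    (h' : ∀ j', j' ≠ j → (j' ∈ O' ↔ j' ∈ O)) :
    Represents facts (role := role) x (Function.update s i (if j ∈ O' then 1 else 0))
      ⟨ph, t, O'⟩ := by
  have hix : x ≠ i := by
    rintro rfl
    rw [hr.role_ctrl] at hi
    cases hi
  refine ⟨by simpa [hix] using h.ctrl, fun k hk => ?_, fun k j' hk => ?_, hO', ?_⟩
  · have : k ≠ i := by
      rintro rfl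
      rw [hi] at hk
      cases hk
    simpa [this] using h.pool k hk
  · by_cases hki : k = i
    · subst hki
      rw [hi] at hk
      cases hk
      simp
    · have hj : j' ≠ j := by
        rintro rfl
        exact hki (hr.fact_inj _ _ _ hk hi)
      simpa [hki, h' j' hj] using h.fact k j' hk
  · rw [filter_update_of_ne]
    · exact h.card
    · intro h2
      have := h.eq_two hr h2
      rw [hi] at this
      cases this
    · split_ifs <;> simp

theorem Represents.update_ctrl (hr : σ.IsRoster facts role x)
    (h : Represents facts (role := role) x s ⟨ph, t, O⟩) (ph' : Phase) :
    Represents facts (role := role) x (Function.update s x ph'.strategy) ⟨ph', t, O⟩ := by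
  have hne : ∀ k, role k ≠ .ctrl → k ≠ x := fun k hk h => hk ((hr.ctrl_iff k).2 h)
  refine ⟨by simp, fun k hk => ?_, fun k j' hk => ?_, h.subset, ?_⟩
  · simpa [hne k (by simp [hk])] using h.pool k hk
  · simpa [hne k (by simp [hk])] using h.fact k j' hk
  · rw [filter_update_of_ne]
    · exact h.card
    · rw [h.ctrl]
      cases ph <;> simp [Phase.strategy]
    · cases ph' <;> simp [Phase.strategy]

theorem Represents.update_pool (hr : σ.IsRoster facts role x)
    (h : Represents facts (role := role) x s ⟨ph, t, O⟩) {i : Fin n} (hi : role i = .pool)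
    {a : Fin 5} (ha : a = 0 ∨ a = 2) {t' : ℕ}
    (ht : (Finset.univ.filter fun k => Function.update s i a k = 2).card = t') :
    Represents facts (role := role) x (Function.update s i a) ⟨ph, t', O⟩ := by
  have hix : x ≠ i := by
    rintro rfl
    rw [hr.role_ctrl] at hi
    cases hi
  refine ⟨by simpa [hix] using h.ctrl, fun k hk => ?_, fun k j' hk => ?_, h.subset, ht⟩
  · by_cases hki : k = i
    · subst hki; simpa using ha
    · simpa [hki] using h.pool k hk
  · have : k ≠ i := by
      rintro rfl
      rw [hi] at hk
      cases hk
    simpa [this] using h.fact k j' hk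

theorem card_update_two {i : Fin n} (h : s i ≠ 2) :
    (Finset.univ.filter fun k => Function.update s i 2 k = 2).card =
      (Finset.univ.filter fun k => s k = 2).card + 1 := by
  rw [← Finset.card_insert_of_notMem (a := i) (by simpa using h)]
  congr 1
  ext k
  by_cases hk : k = i
  · subst hk; simp
  · simp [hk]

theorem card_update_zero {i : Fin n} (h : s i = 2) :
    (Finset.univ.filter fun k => Function.update s i 0 k = 2).card + 1 =
      (Finset.univ.filter fun k => s k = 2).card := by
  rw [← Finset.card_erase_add_one (s := Finset.univ.filter fun k => s k = 2) (a := i)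
    (by simpa using h)]
  congr 2
  ext k
  by_cases hk : k = i
  · subst hk; simp
  · simp [hk]

end Update

/-- Pool players are interchangeable: any one on the appropriate strategy realises a change of the
index. -/
theorem exists_arc_of_abstractArc (hr : σ.IsRoster facts role x) {s : Fin n → Fin 5}
    {y z : AbstractState F} (h : Represents facts (role := role) x s y)
    (hyz : σ.AbstractArc facts y z) :
    ∃ s', (σ.game role).toStrategicGame.Arc s s' ∧ Represents facts (role := role) x s' z := by
  have hon := h.card_on hr
  have htwo := h.card
  have arc : ∀ i a, σ.utility (role i) (s i) (othersPartition s i).1 <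
      σ.utility (role i) a (othersPartition s i).1 →
      (σ.game role).toStrategicGame.Arc s (Function.update s i a) := fun i a hlt =>
    ((σ.game role).arc_iff s _).2 ⟨i, a, rfl, hlt⟩
  cases hyz with
  | @on ph t O j hj hjO hw =>
    obtain ⟨i, hi⟩ := (hr.mem_iff j).1 hj
    have hix : i ≠ x := by
      rintro rfl
      rw [hr.role_ctrl] at hi
      cases hi
    have hsi : s i = 0 := by rw [h.fact i j hi, if_neg hjO]
    have h1 := othersPartition_add s i 1
    have h2 := othersPartition_add s i 2
    simp only [hsi, hon, htwo] at h1 h2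
    refine ⟨_, arc i 1 ?_, ?_⟩
    · have hw' : ¬σ.WantOff ph t O.card j := by
        simp [WantOff, hw.1]
      simp at h1 h2
      simp [hi, hsi, utility, h.phaseOf hr hix, h1, h2, hw, hw']
    · have := h.update_fact hr hi (O' := insert j O) (Finset.insert_subset hj h.subset)
        (fun j' hj' => by simp [hj'])
      rw [if_pos (Finset.mem_insert_self _ _)] at this
      exact this
  | @off ph t O j f hj hf hw =>
    obtain ⟨i, hi⟩ := (hr.mem_iff j).1 (h.subset hj)
    have hix : i ≠ x := by
      rintro rfl
      rw [hr.role_ctrl] at hi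
      cases hi
    have hsi : s i = 1 := by rw [h.fact i j hi, if_pos hj]
    have h1 := othersPartition_add s i 1
    have h2 := othersPartition_add s i 2
    simp only [hsi, hon, htwo] at h1 h2
    refine ⟨_, arc i 0 ?_, ?_⟩
    · have hw' : ¬σ.WantOn ph t f j := by
        rintro ⟨rfl, -⟩
        simp [WantOff] at hw
      simp [hf] at h1 h2
      simp [hi, hsi, utility, h.phaseOf hr hix, h1, h2, hw, hw']
    · have := h.update_fact hr hi (O' := O.erase j) ((Finset.erase_subset _ _).trans h.subset)
        (fun j' hj' => by simp [hj'])
      rw [if_neg (Finset.notMem_erase _ _)] at this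
      exact this
  | @up ph t O ht hw =>
    obtain ⟨i, hi, hsi⟩ : ∃ i, role i = .pool ∧ s i ≠ 2 := by
      by_contra! hall
      classical
      have := hr.card_pool (Finset.univ.filter fun i => s i = 2) fun i => by
        simpa using ⟨h.eq_two hr, hall i⟩
      have := htwo
      simp at this
      omega
    have hsi : s i = 0 := (h.pool i hi).resolve_right hsi
    have hix : i ≠ x := by
      rintro rfl
      rw [hr.role_ctrl] at hi
      cases hi
    have h1 := othersPartition_add s i 1
    simp only [hsi, hon] at h1
    refine ⟨_, arc i 2 ?_, h.update_pool hr hi (.inr rfl) ?_⟩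
    · have hw' : ¬σ.WantDown ph O.card := by
        simp [WantDown, hw.1]
      simp at h1
      simp [hi, hsi, utility, h.phaseOf hr hix, h1, hw, hw']
    · rw [card_update_two (by simp [hsi]), htwo]
  | @down ph t O hw =>
    obtain ⟨i, hsi⟩ : ∃ i, s i = 2 := by
      have : 0 < (Finset.univ.filter fun i => s i = 2).card := by simp [htwo]
      obtain ⟨i, hi⟩ := Finset.card_pos.1 this
      exact ⟨i, by simpa using hi⟩
    have hi := h.eq_two hr hsi
    have hix : i ≠ x := by
      rintro rfl
      rw [hr.role_ctrl] at hi
      cases hi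
    have h1 := othersPartition_add s i 1
    simp only [hsi, hon] at h1
    refine ⟨_, arc i 0 ?_, h.update_pool hr hi (.inl rfl) ?_⟩
    · have hw' : ¬σ.WantUp ph O.card := by
        rintro ⟨rfl, -⟩
        simp [WantDown] at hw
      simp at h1
      simp [hi, hsi, utility, h.phaseOf hr hix, h1, hw, hw']
    · have := card_update_zero hsi
      simp only [htwo] at this
      omega
  | @phase ph ph' t O hlt =>
    refine ⟨_, arc x ph'.strategy ?_, h.update_ctrl hr ph'⟩
    have h1 := othersPartition_add s x 1
    have h2 := othersPartition_add s x 2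
    have hx : s x = ph.strategy := h.ctrl
    have n1 : ph.strategy ≠ 1 := (Phase.strategy_ne ph).1
    have n2 : ph.strategy ≠ 2 := (Phase.strategy_ne ph).2
    rw [hon, hx, if_neg n1, add_zero] at h1
    rw [htwo, hx, if_neg n2, add_zero] at h2
    rw [hr.role_ctrl, hx, utility_ctrl_strategy, utility_ctrl_strategy, h1, h2]
    exact hlt

/-- For pool and fact players utility 2 marks exactly the wanted moves between the two strategies of
the role, so an improving deviation is one of them. -/
theorem exists_abstractArc_of_arc (hr : σ.IsRoster facts role x) {s s' : Fin n → Fin 5}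
    {y : AbstractState F} (h : Represents facts (role := role) x s y)
    (hs : (σ.game role).toStrategicGame.Arc s s') :
    ∃ z, σ.AbstractArc facts y z ∧ Represents facts (role := role) x s' z := by
  obtain ⟨i, a, rfl, hlt⟩ := ((σ.game role).arc_iff s _).1 hs
  change Fin n at i
  change Fin 5 at a
  change σ.utility (role i) (s i) (othersPartition s i).1 <
      σ.utility (role i) a (othersPartition s i).1 at hlt
  have hon := h.card_on hr
  have htwo := h.card
  have h1 := othersPartition_add s i 1
  have h2 := othersPartition_add s i 2
  obtain ⟨ph, t, O⟩ := y
  simp only [hon] at h1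
  simp only [htwo] at h2
  rcases hi : role i with _ | _ | j
  · have hix := (hr.ctrl_iff i).1 hi
    subst hix
    have hx : s i = ph.strategy := h.ctrl
    have n1 : ph.strategy ≠ 1 := (Phase.strategy_ne ph).1
    have n2 : ph.strategy ≠ 2 := (Phase.strategy_ne ph).2
    rw [hx, if_neg n1, add_zero] at h1
    rw [hx, if_neg n2, add_zero] at h2
    rw [hi, hx, utility_ctrl_strategy, h1, h2] at hlt
    obtain ⟨ph', rfl⟩ : ∃ ph' : Phase, a = ph'.strategy := by
      by_contra! hne
      have h0 := hne .reset
      have h3 := hne .consume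
      have h4 := hne .produce
      simp only [Phase.strategy] at h0 h3 h4
      simp only [utility, h0, h3, h4, if_false] at hlt
      exact absurd (rank_pos (σ := σ) t O.card ph) hlt.not_gt
    rw [utility_ctrl_strategy, h1, h2] at hlt
    exact ⟨_, .phase hlt, h.update_ctrl hr ph'⟩
  · have hix : i ≠ x := by
      rintro rfl
      rw [hr.role_ctrl] at hi
      cases hi
    have hp := h.phaseOf hr hix
    rcases h.pool i hi with h0 | h0
    · simp only [h0] at h1 hlt
      simp at h1
      simp only [hi, utility, hp, h1] at hlt
      obtain ⟨rfl, hw⟩ : a = 2 ∧ σ.WantUp ph O.card := by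
        by_contra hne
        revert hlt
        simp only [if_true]
        split_ifs <;> simp_all
      -- The deviating pool player is not yet counted in the index.
      have htm : t < σ.maxIndex := by
        classical
        have hc := hr.card_pool (Finset.univ.filter fun i => role i = .pool) (by simp)
        rw [← hc, ← show _ = t from htwo]
        refine Finset.card_lt_card ⟨fun k hk => ?_, fun hk => ?_⟩
        · simpa using h.eq_two hr (by simpa using hk)
        · have := hk (show i ∈ _ by simpa using hi)
          simp [h0] at this
      exact ⟨_, .up htm hw, h.update_pool hr hi (.inr rfl)
        (by rw [card_update_two (by simp [h0]), htwo])⟩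
    · simp only [h0] at h1 hlt
      simp at h1
      simp only [hi, utility, hp, h1] at hlt
      obtain ⟨rfl, hw⟩ : a = 0 ∧ σ.WantDown ph O.card := by
        by_contra hne
        revert hlt
        split_ifs <;> simp_all
      have hc := card_update_zero h0
      rw [htwo] at hc
      obtain ⟨t, rfl⟩ : ∃ t', t = t' + 1 := ⟨_, hc.symm⟩
      refine ⟨_, .down hw, h.update_pool hr hi (.inl rfl) (by simpa using hc)⟩
  · have hix : i ≠ x := by
      rintro rfl
      rw [hr.role_ctrl] at hi
      cases hi
    have hp := h.phaseOf hr hix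
    have hjf : j ∈ facts := (hr.mem_iff j).2 ⟨i, hi⟩
    by_cases hj : j ∈ O
    · have h0 : s i = 1 := by rw [h.fact i j hi, if_pos hj]
      simp only [h0] at h1 h2 hlt
      simp at h1 h2
      simp only [hi, utility, hp, h2] at hlt
      obtain ⟨rfl, hw⟩ : a = 0 ∧ σ.WantOff ph t ((othersPartition s i).1 1) j := by
        by_contra hne
        revert hlt
        split_ifs <;> simp_all
      -- A player on strategy 1 sees `O.card - 1` facts; this is the `f` of `AbstractArc.off`.
      refine ⟨_, .off hj h1.symm hw, ?_⟩
      have := h.update_fact hr hi (O' := O.erase j) ((Finset.erase_subset _ _).trans h.subset)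
        (fun j' hj' => by simp [hj'])
      rw [if_neg (Finset.notMem_erase _ _)] at this
      exact this
    · have h0 : s i = 0 := by rw [h.fact i j hi, if_neg hj]
      simp only [h0] at h1 h2 hlt
      simp at h1 h2
      simp only [hi, utility, hp, h1, h2] at hlt
      obtain ⟨rfl, hw⟩ : a = 1 ∧ σ.WantOn ph t O.card j := by
        by_contra hne
        revert hlt
        simp only [if_true]
        split_ifs <;> simp_all
      refine ⟨_, .on hjf hj hw, ?_⟩
      have := h.update_fact hr hi (O' := insert j O) (Finset.insert_subset hjf h.subset)
        (fun j' hj' => by simp [hj'])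
      rw [if_pos (Finset.mem_insert_self _ _)] at this
      exact this

theorem exists_reach_of_abstractReach (hr : σ.IsRoster facts role x) {s : Fin n → Fin 5}
    {y z : AbstractState F} (h : Represents facts (role := role) x s y)
    (hyz : σ.AbstractReach facts y z) :
    ∃ s', (σ.game role).toStrategicGame.Reach s s' ∧ Represents facts (role := role) x s' z := by
  induction hyz with
  | refl => exact ⟨s, .refl, h⟩
  | tail _ h' ih =>
    obtain ⟨s', hs, hs'⟩ := ih
    obtain ⟨s'', h1, h2⟩ := exists_arc_of_abstractArc hr hs' h'
    exact ⟨s'', hs.tail h1, h2⟩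

/-- Induction on the number of players on strategies foreign to their role: each can be moved to
strategy 0 at a profit. -/
theorem exists_reach_represents (hr : σ.IsRoster facts role x) (s : Fin n → Fin 5) :
    ∃ s' y, (σ.game role).toStrategicGame.Reach s s' ∧ Represents facts (role := role) x s' y := by
  classical
  let V : Fin n → Fin 5 → Prop := fun i a => match role i with
    | .ctrl => a = 0 ∨ a = 3 ∨ a = 4
    | .pool => a = 0 ∨ a = 2
    | .fact _ => a = 0 ∨ a = 1
  induction hm : (Finset.univ.filter fun i => ¬V i (s i)).card generalizing s with
  | zero =>
    have hV : ∀ i, V i (s i) := by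
      simpa using hm
    obtain ⟨ph, hph⟩ : ∃ ph : Phase, s x = ph.strategy := by
      have := hV x
      simp only [V, hr.role_ctrl] at this
      rcases this with h | h | h
      exacts [⟨.reset, h⟩, ⟨.consume, h⟩, ⟨.produce, h⟩]
    refine ⟨s, ⟨ph, _, facts.filter fun j => ∃ i, role i = .fact j ∧ s i = 1⟩, .refl, hph, ?_, ?_,
      Finset.filter_subset _ _, rfl⟩
    · intro i hi
      have := hV i
      simpa only [V, hi] using this
    · intro i j hi
      have h01 := hV i
      simp only [V, hi] at h01
      have hj : j ∈ facts := (hr.mem_iff j).2 ⟨i, hi⟩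
      by_cases h1 : s i = 1
      · rw [if_pos]
        · exact h1
        · simpa [hj] using ⟨i, hi, h1⟩
      · rw [if_neg]
        · exact h01.resolve_right h1
        · simp only [Finset.mem_filter, not_and, not_exists]
          intro _ i' hi' h
          exact h1 (hr.fact_inj _ _ _ hi hi' ▸ h)
  | succ m ih =>
    obtain ⟨i, hi⟩ : (Finset.univ.filter fun i => ¬V i (s i)).Nonempty := by
      rw [← Finset.card_pos]
      omega
    have hi' : ¬V i (s i) := by simpa using hi
    have h0 : V i 0 := by
      simp only [V]
      split <;> simp
    obtain ⟨s', y, h1, h2⟩ := ih (Function.update s i 0) (by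
      have : (Finset.univ.filter fun k => ¬V k (Function.update s i 0 k)) =
          (Finset.univ.filter fun k => ¬V k (s k)).erase i := by
        ext k
        by_cases hk : k = i
        · subst hk; simp [h0]
        · simp [hk]
      rw [this, Finset.card_erase_of_mem hi, hm]
      rfl)
    refine ⟨s', y, .head (((σ.game role).arc_iff s _).2 ⟨i, (0 : Fin 5), rfl, ?_⟩) h1, h2⟩
    show σ.utility (role i) (s i) (othersPartition s i).1 < σ.utility (role i) 0 _
    have : σ.utility (role i) (s i) (othersPartition s i).1 = 0 := by
      simp only [V] at hi'
      rcases hri : role i with _ | _ | j <;> simp only [hri, not_or] at hi' <;>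
        simp [utility, hi']
    rw [this]
    exact utility_zero_pos _ _

/-- An abstract state only forgets which pool players are counted, and at index 0 none is. Hence a
return to the abstract start is a return to the same profile. -/
theorem Represents.unique (hr : σ.IsRoster facts role x) {s s' : Fin n → Fin 5} {ph : Phase}
    {O : Finset F} (h : Represents facts (role := role) x s ⟨ph, 0, O⟩)
    (h' : Represents facts (role := role) x s' ⟨ph, 0, O⟩) : s = s' := by
  funext i
  rcases hi : role i with _ | _ | j
  · rw [(hr.ctrl_iff i).1 hi, h.ctrl, h'.ctrl]
  · have h1 : ∀ s : Fin n → Fin 5, Represents facts (role := role) x s ⟨ph, 0, O⟩ → s i = 0 := by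
      intro s h
      refine (h.pool i hi).resolve_right fun h2 => ?_
      have := Finset.card_eq_zero.1 h.card
      have hmem : i ∈ Finset.univ.filter fun i => s i = 2 := by simpa using h2
      rw [this] at hmem
      simp at hmem
    rw [h1 s h, h1 s' h']
  · rw [h.fact i j hi, h'.fact i j hi]

/-- The game of a token system has a non-singleton sink if and only if the token system cannot
reach a state in which a rejecting transition is enabled. -/
theorem hasNonSingletonSink_iff (hr : σ.IsRoster facts role x) (hσ : σ.Regular facts)
    (hd : ∀ t c, σ.produce₁ t c → ¬σ.reject t) :
    (σ.game role).toStrategicGame.HasNonSingletonSink ↔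
      ∀ O t a b, σ.Reaches facts O → σ.Fires O t a b → ¬σ.reject t := by
  constructor
  · intro h O t a b hO hf ht
    refine StrategicGame.not_hasNonSingletonSink (fun s => ?_) h
    obtain ⟨s', y, h1, h2⟩ := exists_reach_represents hr s
    obtain ⟨z, hyz, hz⟩ := exists_reach_stuck hσ hd hO hf ht y
    obtain ⟨s'', h3, h4⟩ := exists_reach_of_abstractReach hr h2 hyz
    refine ⟨s'', h1.trans h3, fun t' ht' => ?_⟩
    obtain ⟨w, hw, _⟩ := exists_abstractArc_of_arc hr h4 ht'
    exact hz w hw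
  · intro hrej
    obtain ⟨s₀, hs₀⟩ : ∃ s₀, Represents facts (role := role) x s₀ (σ.start facts) := by
      -- A profile representing the start is found by cleaning up an arbitrary profile, putting the
      -- control player on `reset` by hand, and following the reset.
      obtain ⟨s', y, _, h2⟩ := exists_reach_represents hr fun _ => 0
      obtain ⟨ph, t, O⟩ := y
      have h2 := h2.update_ctrl hr .reset
      obtain ⟨s'', _, h4⟩ := exists_reach_of_abstractReach hr h2 (reach_start_of_reset hσ)
      exact ⟨s'', h4⟩
    -- The move from the start to `reset` supplies the second vertex of the sink.
    obtain ⟨s₁, h1, hs₁⟩ := exists_arc_of_abstractArc hr hs₀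
      (.phase (ph' := .reset) (by simp [rank, hσ.card_initialSet]))
    refine StrategicGame.hasNonSingletonSink_of_recurrent h1 ?_ fun r hsr => ?_
    · rintro rfl
      have := hs₀.ctrl.symm.trans hs₁.ctrl
      simp [start, Phase.strategy] at this
    · obtain ⟨y, hy, hr'⟩ : ∃ y, σ.Simulating facts y ∧ Represents facts (role := role) x r y := by
        induction hsr with
        | refl => exact ⟨_, .consume (Nat.zero_le _) .refl, hs₀⟩
        | tail _ h ih =>
          obtain ⟨y, hy, hr'⟩ := ih
          obtain ⟨z, hz, hz'⟩ := exists_abstractArc_of_arc hr hr' h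
          exact ⟨z, hy.arc hσ hrej hz, hz'⟩
      obtain ⟨s', h2, h3⟩ := exists_reach_of_abstractReach hr hr' (hy.reach_start hσ hrej)
      rwa [h3.unique hr hs₀] at h2

end TokenSystem

/-! ### A concrete list of players. -/

namespace TokenSystem

/-- The roles of the players: a control player, `m` pool players and one player per fact. -/
def roleList {F : Type} (m : ℕ) (l : List F) : List (Role F) :=
  .ctrl :: (List.replicate m .pool ++ l.map .fact)

variable {F : Type} (m : ℕ) (l : List F)

theorem roleList_get_cases (i : Fin (roleList m l).length) :
    (i : ℕ) = 0 ∧ (roleList m l).get i = .ctrl ∨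
      (0 < (i : ℕ) ∧ (i : ℕ) ≤ m) ∧ (roleList m l).get i = .pool ∨
      ∃ (k : ℕ) (h : k < l.length), (i : ℕ) = m + 1 + k ∧ (roleList m l).get i = .fact l[k] := by
  obtain ⟨i, hi⟩ := i
  rcases i with _ | i
  · exact .inl ⟨rfl, rfl⟩
  · right
    simp only [roleList, List.length_cons, List.length_append, List.length_replicate,
      List.length_map] at hi
    by_cases h : i < m
    · left
      refine ⟨⟨by simp, h⟩, ?_⟩
      simp [roleList, h]
    · right
      refine ⟨i - m, by omega, by simp; omega, ?_⟩
      simp [roleList, List.getElem_append, h]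

theorem isRoster_roleList [DecidableEq F] (σ : TokenSystem F) (hl : l.Nodup) :
    σ.IsRoster l.toFinset (roleList σ.maxIndex l).get ⟨0, by simp [roleList]⟩ := by
  have hlen : (roleList σ.maxIndex l).length = σ.maxIndex + l.length + 1 := by simp [roleList]
  refine ⟨fun i => ?_, fun P hP => ?_, fun i i' j hi hi' => ?_, fun j => ?_⟩
  · rw [Fin.ext_iff]
    rcases roleList_get_cases σ.maxIndex l i with ⟨h, h'⟩ | ⟨h, h'⟩ | ⟨k, hk, h, h'⟩ <;>
      rw [h'] <;> simp <;> omega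
  · have : P.map Fin.valEmbedding = Finset.Ioc 0 σ.maxIndex := by
      ext k
      simp only [Finset.mem_map, Fin.valEmbedding_apply, Finset.mem_Ioc]
      constructor
      · rintro ⟨i, hi, rfl⟩
        rw [hP] at hi
        rcases roleList_get_cases σ.maxIndex l i with ⟨h, h'⟩ | ⟨h, h'⟩ | ⟨k, hk, h, h'⟩
        · rw [h'] at hi; cases hi
        · exact h
        · rw [h'] at hi; cases hi
      · intro hk
        have hlt : k < (roleList σ.maxIndex l).length := by omega
        refine ⟨⟨k, hlt⟩, ?_, rfl⟩
        rw [hP]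
        rcases roleList_get_cases σ.maxIndex l ⟨k, hlt⟩ with ⟨h, h'⟩ | ⟨h, h'⟩ | ⟨k', hk', h, h'⟩
        · simp at h; omega
        · exact h'
        · simp at h; omega
    rw [← Finset.card_map Fin.valEmbedding, this]
    simp
  · rcases roleList_get_cases σ.maxIndex l i with ⟨h, h'⟩ | ⟨h, h'⟩ | ⟨k, hk, h, h'⟩ <;>
      rw [h'] at hi <;> try cases hi
    rcases roleList_get_cases σ.maxIndex l i' with ⟨h2, h2'⟩ | ⟨h2, h2'⟩ | ⟨k', hk', h2, h2'⟩ <;>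
      rw [h2'] at hi' <;> try cases hi'
    have hkk : k = k' := by
      rw [Role.fact.injEq] at hi'
      exact (hl.getElem_inj_iff.1 hi'.symm)
    ext
    omega
  · rw [List.mem_toFinset]
    constructor
    · intro hj
      obtain ⟨k, hk, rfl⟩ := List.getElem_of_mem hj
      have hlt : σ.maxIndex + 1 + k < (roleList σ.maxIndex l).length := by omega
      refine ⟨⟨_, hlt⟩, ?_⟩
      rcases roleList_get_cases σ.maxIndex l ⟨_, hlt⟩ with ⟨h, h'⟩ | ⟨h, h'⟩ | ⟨k', hk', h, h'⟩
      · simp at h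
      · simp at h; omega
      · rw [h']
        have : k' = k := by simp at h; omega
        subst this
        rfl
    · rintro ⟨i, hi⟩
      rcases roleList_get_cases σ.maxIndex l i with ⟨h, h'⟩ | ⟨h, h'⟩ | ⟨k, hk, h, h'⟩ <;>
        rw [h'] at hi <;> try cases hi
      simp

end TokenSystem

/-! ### Token systems that simulate Turing machines -/

namespace MachineTokens

open Turing

variable {Γ Λ : Type} [Inhabited Γ] [Inhabited Λ] [Fintype Γ] [Fintype Λ]

/-- Facts: `(p, Sum.inl q)` says that the head is on cell `p` and the state is `q`, and
`(p, Sum.inr x)` says that cell `p` contains the symbol `x`. -/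
abbrev Fact (Γ Λ : Type) : Type := ℕ × (Λ ⊕ Γ)

/-- The index of the transition for the state `y.1` and the symbol `y.2` at cell `p`. -/
noncomputable def index (p : ℕ) (y : Λ × Γ) : ℕ :=
  -- The `p + 1` keeps index 0 free: it is the resting value of the counter and signals the
  -- rebuilding of the initial facts.
  Fintype.card (Λ × Γ) * (p + 1) + Fintype.equivFin (Λ × Γ) y

omit [Inhabited Γ] [Inhabited Λ] in
theorem index_inj {p p' : ℕ} {y y' : Λ × Γ} (h : index p y = index p' y') : p = p' ∧ y = y' := by
  have hy := (Fintype.equivFin (Λ × Γ) y).2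
  have hy' := (Fintype.equivFin (Λ × Γ) y').2
  unfold index at h
  have hp : p = p' := by
    rcases lt_trichotomy p p' with hlt | h' | hlt
    · obtain ⟨k, rfl⟩ := Nat.exists_eq_add_of_lt hlt
      have : Fintype.card (Λ × Γ) * (p + k + 1 + 1) =
        Fintype.card (Λ × Γ) * (p + 1) + Fintype.card (Λ × Γ) * k + Fintype.card (Λ × Γ) := by ring
      have := Nat.zero_le (Fintype.card (Λ × Γ) * k)
      omega
    · exact h'
    · obtain ⟨k, rfl⟩ := Nat.exists_eq_add_of_lt hlt
      have : Fintype.card (Λ × Γ) * (p' + k + 1 + 1) =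
        Fintype.card (Λ × Γ) * (p' + 1) + Fintype.card (Λ × Γ) * k + Fintype.card (Λ × Γ) := by ring
      have := Nat.zero_le (Fintype.card (Λ × Γ) * k)
      omega
  subst hp
  exact ⟨rfl, (Fintype.equivFin (Λ × Γ)).injective (Fin.ext (by omega))⟩

omit [Inhabited Γ] [Inhabited Λ] in
theorem index_le {p n : ℕ} (hp : p ≤ n) (y : Λ × Γ) :
    index p y ≤ Fintype.card (Λ × Γ) * (n + 2) := by
  have hy := (Fintype.equivFin (Λ × Γ) y).2
  have h1 : Fintype.card (Λ × Γ) * (p + 2) ≤ Fintype.card (Λ × Γ) * (n + 2) := by gcongr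
  have h2 : Fintype.card (Λ × Γ) * (p + 2) =
    Fintype.card (Λ × Γ) * (p + 1) + Fintype.card (Λ × Γ) := by ring
  unfold index
  omega

theorem index_pos (p : ℕ) (y : Λ × Γ) : 0 < index p y := by
  have : 0 < Fintype.card (Λ × Γ) * (p + 1) := by
    have : 0 < Fintype.card (Λ × Γ) := Fintype.card_pos_iff.2 ⟨default⟩
    positivity
  unfold index
  omega

/-- The cell of the head after a statement. Cells are numbered from right to left. -/
def target (p : ℕ) : TM0.Stmt Γ → ℕ
  | .move .left => p + 1
  | .move .right => p - 1
  | .write _ => p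

/-- The symbol at the former cell of the head after a statement. -/
def written (x : Γ) : TM0.Stmt Γ → Γ
  | .move _ => x
  | .write y => y

/-- The initial content of cell `p`. -/
def initialTape (inp : Bool → Γ) (B : ℕ) (w : List Bool) (p : ℕ) : Γ :=
  -- Cell `p` stands for tape position `B + w.length - p`, so the cells up to `2 * B + w.length`
  -- cover the positions from `-B` to `B + w.length`. Past the end of the input, `getI` returns the
  -- blank.
  if p ≤ B + w.length then (w.map inp).getI (B + w.length - p) else default

variable (M : TM0.Machine Γ Λ) (inp : Bool → Γ) (accept : Set Λ) (B : ℕ) (w : List Bool)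

/-- The token system that simulates a Turing machine on the input `w`, on the cells at distance at
most `B` from the input. -/
noncomputable def system : TokenSystem (Fact Γ Λ) where
  consume₁ t j := ∃ (p : ℕ) (y : Λ × Γ), t = index p y ∧ j = (p, .inl y.1)
  consume₂ t j := ∃ (p : ℕ) (y : Λ × Γ), t = index p y ∧ j = (p, .inr y.2)
  produce₁ t j := ∃ (p : ℕ) (y : Λ × Γ) (z : Λ × TM0.Stmt Γ), t = index p y ∧
    M y.1 y.2 = some z ∧ j = (target p z.2, .inl z.1)
  produce₂ t j := ∃ (p : ℕ) (y : Λ × Γ) (z : Λ × TM0.Stmt Γ), t = index p y ∧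
    M y.1 y.2 = some z ∧ j = (p, .inr (written y.2 z.2))
  initial j := j = (B + w.length, .inl default) ∨ j = (j.1, .inr (initialTape inp B w j.1))
  reject t := ∃ (p : ℕ) (y : Λ × Γ), t = index p y ∧ M y.1 y.2 = none ∧ y.1 ∉ accept
  size := 2 * B + w.length
  maxIndex := Fintype.card (Λ × Γ) * (2 * B + w.length + 2)

/-- The list of all facts about the cells `n, …, 0`. -/
noncomputable def factList (Γ Λ : Type) [Fintype Γ] [Fintype Λ] (n : ℕ) : List (Fact Γ Λ) :=
  (List.range (n + 1)).reverse.flatMap fun p => (Finset.univ : Finset (Λ ⊕ Γ)).toList.map (p, ·)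

omit [Inhabited Γ] [Inhabited Λ] in
theorem mem_factList {n : ℕ} {j : Fact Γ Λ} : j ∈ factList Γ Λ n ↔ j.1 ≤ n := by
  obtain ⟨p, y⟩ := j
  simp [factList]

omit [Inhabited Γ] [Inhabited Λ] in
theorem nodup_factList (n : ℕ) : (factList Γ Λ n).Nodup := by
  refine List.nodup_flatMap.2 ⟨fun p _ => (Finset.nodup_toList _).map fun a b h => by
    simpa using h, ?_⟩
  refine (List.nodup_reverse.2 List.nodup_range).imp fun {p p'} hne => ?_
  simp only [Function.onFun, List.disjoint_left, List.mem_map, not_exists, not_and]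
  rintro _ ⟨y, _, rfl⟩ y' _ h
  exact hne (congrArg Prod.fst h).symm

variable [DecidableEq Γ] [DecidableEq Λ]

/-- The facts that hold in a configuration with head position `p`, state `q` and tape `T`. -/
def encodeCfg (n p : ℕ) (q : Λ) (T : ℕ → Γ) : Finset (Fact Γ Λ) :=
  insert (p, .inl q) ((Finset.range (n + 1)).image fun p' => (p', .inr (T p')))

omit [Inhabited Γ] [Inhabited Λ] [Fintype Γ] [Fintype Λ] in
theorem mem_encodeCfg {n p : ℕ} {q : Λ} {T : ℕ → Γ} {j : Fact Γ Λ} :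
    j ∈ encodeCfg n p q T ↔ j = (p, .inl q) ∨ j.1 ≤ n ∧ j = (j.1, .inr (T j.1)) := by
  simp only [encodeCfg, Finset.mem_insert, Finset.mem_image, Finset.mem_range, Nat.lt_succ_iff]
  refine or_congr_right ⟨?_, fun h => ⟨j.1, h.1, h.2.symm⟩⟩
  rintro ⟨p', h, rfl⟩
  exact ⟨h, rfl⟩

omit [Inhabited Γ] [Inhabited Λ] [Fintype Γ] [Fintype Λ] in
theorem card_encodeCfg (n p : ℕ) (q : Λ) (T : ℕ → Γ) : (encodeCfg n p q T).card = n + 2 := by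
  rw [encodeCfg, Finset.card_insert_of_notMem (by simp),
    Finset.card_image_of_injective, Finset.card_range]
  exact fun a b h => congrArg Prod.fst h

/-- The set of all facts about the cells `0, …, n`. -/
noncomputable def factSet (Γ Λ : Type) [Fintype Γ] [Fintype Λ] [DecidableEq Γ] [DecidableEq Λ]
    (n : ℕ) : Finset (Fact Γ Λ) :=
  (factList Γ Λ n).toFinset

omit [Inhabited Γ] [Inhabited Λ] in
theorem mem_factSet {n : ℕ} {j : Fact Γ Λ} : j ∈ factSet Γ Λ n ↔ j.1 ≤ n := by
  rw [factSet, List.mem_toFinset, mem_factList]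

theorem initialSet_system : (system M inp accept B w).initialSet (factSet Γ Λ (2 * B + w.length)) =
    encodeCfg (2 * B + w.length) (B + w.length) default (initialTape inp B w) := by
  ext j
  rw [TokenSystem.mem_initialSet, mem_factSet, mem_encodeCfg]
  simp only [system]
  constructor
  · rintro ⟨h, h' | h'⟩
    · exact .inl h'
    · exact .inr ⟨h, h'⟩
  · rintro (h | h)
    · exact ⟨by rw [h]; simp; omega, .inl h⟩
    · exact ⟨h.1, .inr h.2⟩

theorem regular_system : (system M inp accept B w).Regular (factSet Γ Λ (2 * B + w.length)) where
  card_initialSet := by rw [initialSet_system, card_encodeCfg]; rfl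
  not_consume₁ := by
    rintro j ⟨p, y, h, _⟩
    exact (index_pos p y).ne h
  not_produce₁ := by
    rintro j ⟨p, y, _, h, _⟩
    exact (index_pos p y).ne h
  not_produce₂ := by
    rintro j ⟨p, y, _, h, _⟩
    exact (index_pos p y).ne h
  not_reject := by
    rintro ⟨p, y, h, _⟩
    exact (index_pos p y).ne h

omit [DecidableEq Γ] [DecidableEq Λ] in
theorem not_reject_of_produce {t : ℕ} {c : Fact Γ Λ} (h : (system M inp accept B w).produce₁ t c) :
    ¬(system M inp accept B w).reject t := by
  obtain ⟨p, y, z, rfl, hM, _⟩ := h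
  rintro ⟨p', y', h, hM', _⟩
  obtain ⟨rfl, rfl⟩ := index_inj h
  rw [hM] at hM'
  cases hM'

variable {M inp accept B w}

/-- A configuration contains one state fact and one symbol per cell. The state fact fixes head and
state, and the shared index then forces the symbol of that cell, so exactly one transition is
enabled. -/
theorem fires_iff {n p : ℕ} {q : Λ} {T : ℕ → Γ} (hp : p ≤ n) (hn : n = 2 * B + w.length) {t : ℕ}
    {a b : Fact Γ Λ} :
    (system M inp accept B w).Fires (encodeCfg n p q T) t a b ↔
      t = index p (q, T p) ∧ a = (p, .inl q) ∧ b = (p, .inr (T p)) := by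
  constructor
  · rintro ⟨-, ha, hb, ⟨p', y, rfl, rfl⟩, ⟨p'', y', h, rfl⟩⟩
    obtain ⟨rfl, rfl⟩ := index_inj h
    rw [Finset.mem_erase, mem_encodeCfg] at hb
    rw [mem_encodeCfg] at ha
    simp at ha hb
    obtain ⟨rfl, hq⟩ := ha
    obtain ⟨q', x⟩ := y
    simp only at hq hb
    obtain ⟨_, rfl⟩ := hb
    subst hq
    exact ⟨rfl, rfl, rfl⟩
  · rintro ⟨rfl, rfl, rfl⟩
    refine ⟨?_, mem_encodeCfg.2 (.inl rfl), ?_, ⟨p, _, rfl, rfl⟩, ⟨p, _, rfl, rfl⟩⟩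
    · exact index_le (hn ▸ hp) _
    · exact Finset.mem_erase.2 ⟨by simp, mem_encodeCfg.2 (.inr ⟨hp, rfl⟩)⟩

omit [Inhabited Γ] [Inhabited Λ] [Fintype Γ] [Fintype Λ] in
theorem insert_encodeCfg {n p : ℕ} {q : Λ} {T : ℕ → Γ} (hp : p ≤ n) (p' : ℕ) (q' : Λ) (x : Γ) :
    insert (p, .inr x) (insert (p', .inl q')
      (((encodeCfg n p q T).erase (p, .inl q)).erase (p, .inr (T p)))) =
    encodeCfg n p' q' (Function.update T p x) := by
  ext ⟨i, y⟩
  rcases y with y | y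
  · simp [mem_encodeCfg]
  · simp only [Finset.mem_insert, Finset.mem_erase, mem_encodeCfg, Prod.mk.injEq, reduceCtorEq,
      and_false, false_or, Sum.inr.injEq, true_and, ne_eq, not_and, not_false_eq_true]
    by_cases hi : i = p
    · subst hi
      simp only [Function.update_self, true_and]
      constructor
      · rintro (h | h)
        · exact ⟨hp, h⟩
        · exact absurd h.2.2 (h.1 trivial)
      · exact fun h => .inl h.2
    · simp [hi]

theorem step_iff {n p : ℕ} {q : Λ} {T : ℕ → Γ} (hp : p ≤ n) (hn : n = 2 * B + w.length)
    {O' : Finset (Fact Γ Λ)} :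
    (system M inp accept B w).Step (factSet Γ Λ (2 * B + w.length)) (encodeCfg n p q T) O' ↔
      ∃ z, M q (T p) = some z ∧ target p z.2 ≤ n ∧
        O' = encodeCfg n (target p z.2) z.1 (Function.update T p (written (T p) z.2)) := by
  constructor
  · rintro ⟨t, a, b, c, d, hf, hc, -, ⟨p', y', z, h, hM, rfl⟩, -, -,
      ⟨p'', y'', z', h', hM', rfl⟩, rfl⟩
    obtain ⟨rfl, rfl, rfl⟩ := (fires_iff hp hn).1 hf
    obtain ⟨rfl, rfl⟩ := index_inj h
    obtain ⟨rfl, rfl⟩ := index_inj h'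
    rw [hM] at hM'
    cases hM'
    rw [mem_factSet] at hc
    exact ⟨z, hM, hn ▸ hc, insert_encodeCfg hp _ _ _⟩
  · rintro ⟨z, hM, hz, rfl⟩
    refine ⟨_, _, _, _, _, (fires_iff hp hn).2 ⟨rfl, rfl, rfl⟩, ?_, ?_, ⟨p, _, z, rfl, hM, rfl⟩, ?_,
      ?_, ⟨p, _, z, rfl, hM, rfl⟩, (insert_encodeCfg hp _ _ _).symm⟩
    · rw [mem_factSet]
      exact hn ▸ hz
    · simp [mem_encodeCfg]
    · rw [mem_factSet]
      exact hn ▸ hp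
    · simp [mem_encodeCfg]
      tauto

/-- The cell of the head in a configuration with head position `c.2`. -/
def headCell (B : ℕ) (w : List Bool) (c : TM0.Cfg Γ Λ × ℤ) : ℕ :=
  (B + w.length - c.2 : ℤ).toNat

/-- The contents of the cells in a configuration with head position `c.2`. -/
def cellTape (B : ℕ) (w : List Bool) (c : TM0.Cfg Γ Λ × ℤ) (p : ℕ) : Γ :=
  c.1.Tape.nth (B + w.length - p - c.2)

omit [Inhabited Λ] [Fintype Γ] [Fintype Λ] [DecidableEq Γ] [DecidableEq Λ] in
theorem cast_headCell {c : TM0.Cfg Γ Λ × ℤ} (hc : |c.2| ≤ B) :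
    (headCell B w c : ℤ) = B + w.length - c.2 := by
  rw [abs_le] at hc
  unfold headCell
  omega

omit [Inhabited Λ] [Fintype Γ] [Fintype Λ] [DecidableEq Γ] [DecidableEq Λ] in
theorem headCell_le {c : TM0.Cfg Γ Λ × ℤ} (hc : |c.2| ≤ B) : headCell B w c ≤ 2 * B + w.length := by
  have := cast_headCell (w := w) hc
  rw [abs_le] at hc
  omega

omit [Inhabited Λ] [Fintype Γ] [Fintype Λ] [DecidableEq Γ] [DecidableEq Λ] in
theorem cellTape_headCell {c : TM0.Cfg Γ Λ × ℤ} (hc : |c.2| ≤ B) :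
    cellTape B w c (headCell B w c) = c.1.Tape.head := by
  rw [cellTape, cast_headCell hc,
    show (B + w.length - (B + w.length - c.2) - c.2 : ℤ) = 0 by ring, Tape.nth_zero]

/-- The facts that hold in a configuration of the Turing machine with the given head position. -/
def encodeTracked (B : ℕ) (w : List Bool) (c : TM0.Cfg Γ Λ × ℤ) : Finset (Fact Γ Λ) :=
  encodeCfg (2 * B + w.length) (headCell B w c) c.1.q (cellTape B w c)

theorem encodeTracked_init :
    encodeTracked B w (TM0.init (w.map inp), 0) =
      (system M inp accept B w).initialSet (factSet Γ Λ (2 * B + w.length)) := by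
  rw [initialSet_system, encodeTracked]
  have h1 : (B + w.length - 0 : ℤ).toNat = B + w.length := by omega
  have h2 : cellTape B w (TM0.init (Λ := Λ) (w.map inp), 0) = initialTape inp B w := by
    funext p
    simp only [cellTape, TM0.init, Tape.mk₁, Tape.mk₂, initialTape, sub_zero]
    split_ifs with hp
    · have : (B + w.length - p : ℤ) = ((B + w.length - p : ℕ) : ℤ) := by omega
      rw [this, Tape.mk'_nth_nat, ListBlank.nth_mk]
    -- These cells lie to the left of the input, where the tape is blank.
    · obtain ⟨k, hk⟩ : ∃ k : ℕ, (B + w.length - p : ℤ) = -(k + 1 : ℕ) :=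
        ⟨p - (B + w.length) - 1, by omega⟩
      rw [hk]
      show ((ListBlank.mk []).nth k : Γ) = default
      rw [ListBlank.nth_mk, List.getI_nil]
  rw [h2, headCell, h1]
  rfl

/-- The configuration after a step with the result `z` of the transition function. -/
def nextTracked (c : TM0.Cfg Γ Λ × ℤ) (z : Λ × TM0.Stmt Γ) : TM0.Cfg Γ Λ × ℤ :=
  match z.2 with
  | .move .left => (⟨z.1, c.1.Tape.move .left⟩, c.2 - 1)
  | .move .right => (⟨z.1, c.1.Tape.move .right⟩, c.2 + 1)
  | .write y => (⟨z.1, c.1.Tape.write y⟩, c.2)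

omit [Fintype Γ] [Fintype Λ] [DecidableEq Γ] [DecidableEq Λ] in
theorem trackedStep_eq (c : TM0.Cfg Γ Λ × ℤ) :
    trackedStep M c = (M c.1.q c.1.Tape.head).map (nextTracked c) := by
  obtain ⟨⟨q, T⟩, pos⟩ := c
  simp only [trackedStep, TM0.step, Option.map_map]
  rcases hM : M q T.head with _ | ⟨q', (_ | _) | y⟩ <;> rfl

omit [Inhabited Λ] [Fintype Γ] [Fintype Λ] in
theorem encodeTracked_nextTracked {c : TM0.Cfg Γ Λ × ℤ} (hc : |c.2| ≤ B) (z : Λ × TM0.Stmt Γ) :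
    encodeTracked B w (nextTracked c z) =
      encodeCfg (2 * B + w.length) (target (headCell B w c) z.2) z.1
        (Function.update (cellTape B w c) (headCell B w c) (written c.1.Tape.head z.2)) := by
  have hp := cast_headCell (w := w) hc
  have hT := cellTape_headCell (w := w) hc
  rw [abs_le] at hc
  rcases z with ⟨q', (_ | _) | y⟩ <;> simp only [target, written, encodeTracked, nextTracked]
  · rw [← hT, Function.update_eq_self]
    congr 1
    · unfold headCell
      omega
    · funext p
      simp only [cellTape]
      rw [Tape.move_left_nth]
      congr 1
      ring
  · rw [← hT, Function.update_eq_self]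
    congr 1
    -- At cell 0 the truncated subtraction in `target` agrees with `toNat`.
    · unfold headCell
      omega
    · funext p
      simp only [cellTape]
      rw [Tape.move_right_nth]
      congr 1
      ring
  · congr 1
    funext p
    simp only [cellTape]
    rw [Tape.write_nth, Function.update_apply]
    refine if_congr ?_ rfl rfl
    omega

/-- The token system can only add facts about cells in its range; the bound on the next head
position ensures that no machine step is lost for this reason. -/
theorem step_encodeTracked {c : TM0.Cfg Γ Λ × ℤ} (hc : |c.2| ≤ B)
    (hc' : ∀ c', trackedStep M c = some c' → |c'.2| ≤ B) {O' : Finset (Fact Γ Λ)} :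
    (system M inp accept B w).Step (factSet Γ Λ (2 * B + w.length)) (encodeTracked B w c) O' ↔
      ∃ c', trackedStep M c = some c' ∧ O' = encodeTracked B w c' := by
  have hp := cast_headCell (w := w) hc
  rw [encodeTracked, step_iff (headCell_le hc) rfl, cellTape_headCell hc]
  constructor
  · rintro ⟨z, hM, -, rfl⟩
    exact ⟨nextTracked c z, by rw [trackedStep_eq, hM]; rfl, (encodeTracked_nextTracked hc z).symm⟩
  · rintro ⟨c', h, rfl⟩
    have hc' := abs_le.1 (hc' c' h)
    have hc2 := abs_le.1 hc
    rw [trackedStep_eq, Option.map_eq_some_iff] at h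
    obtain ⟨z, hM, rfl⟩ := h
    refine ⟨z, hM, ?_, encodeTracked_nextTracked hc z⟩
    rcases z with ⟨q', (_ | _) | y⟩ <;> simp only [target, nextTracked] at hc' ⊢ <;> omega

theorem reaches_iff (hB : ∀ c pos, StateTransition.Reaches (trackedStep M)
      (TM0.init (w.map inp), 0) (c, pos) → |pos| ≤ B) {O : Finset (Fact Γ Λ)} :
    (system M inp accept B w).Reaches (factSet Γ Λ (2 * B + w.length)) O ↔
      ∃ c, StateTransition.Reaches (trackedStep M) (TM0.init (w.map inp), 0) c ∧
        O = encodeTracked B w c := by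
  constructor
  · intro h
    induction h with
    | refl => exact ⟨_, .refl, encodeTracked_init.symm⟩
    | tail _ h ih =>
      obtain ⟨c, hc, rfl⟩ := ih
      obtain ⟨c', h1, rfl⟩ := (step_encodeTracked (hB _ _ hc)
        fun c' hc' => hB _ _ (Relation.ReflTransGen.tail hc hc')).1 h
      exact ⟨c', Relation.ReflTransGen.tail hc h1, rfl⟩
  · rintro ⟨c, hc, rfl⟩
    induction hc with
    | refl => rw [encodeTracked_init]; exact .refl
    | tail hc h ih =>
      exact .tail ih ((step_encodeTracked (hB _ _ hc)
        fun c' hc' => hB _ _ (Relation.ReflTransGen.tail hc hc')).2 ⟨_, h, rfl⟩)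

omit [Fintype Γ] [Fintype Λ] [DecidableEq Γ] [DecidableEq Λ] in
theorem exists_tracked {c c' : TM0.Cfg Γ Λ} (h : StateTransition.Reaches (TM0.step M) c c')
    (pos : ℤ) : ∃ pos', StateTransition.Reaches (trackedStep M) (c, pos) (c', pos') := by
  induction h with
  | refl => exact ⟨pos, .refl⟩
  | @tail c₁ c₂ _ h ih =>
    obtain ⟨pos', ih⟩ := ih
    obtain ⟨x, hx⟩ : ∃ x, trackedStep M (c₁, pos') = some (c₂, x) := by
      rw [Option.mem_def] at h
      simp only [trackedStep, h, Option.map_some]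
      exact ⟨_, rfl⟩
    exact ⟨x, Relation.ReflTransGen.tail ih hx⟩

omit [Fintype Γ] [Fintype Λ] [DecidableEq Γ] [DecidableEq Λ] in
theorem reaches_of_tracked {c c' : TM0.Cfg Γ Λ × ℤ}
    (h : StateTransition.Reaches (trackedStep M) c c') :
    StateTransition.Reaches (TM0.step M) c.1 c'.1 := by
  induction h with
  | refl => exact .refl
  | tail _ h ih =>
    refine .tail ih ?_
    rw [Option.mem_def, trackedStep, Option.map_eq_some_iff] at h
    obtain ⟨c'', h, rfl⟩ := h
    exact h

/-- A rejecting transition is enabled only in a halting configuration with a non-accepting state,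
and the halting configuration of a deterministic run is unique. -/
theorem not_reject_iff (hB : ∀ c pos, StateTransition.Reaches (trackedStep M)
      (TM0.init (w.map inp), 0) (c, pos) → |pos| ≤ B) {c : TM0.Cfg Γ Λ}
    (hc : c ∈ StateTransition.eval (TM0.step M) (TM0.init (w.map inp))) :
    (∀ O t a b, (system M inp accept B w).Reaches (factSet Γ Λ (2 * B + w.length)) O →
      (system M inp accept B w).Fires O t a b → ¬(system M inp accept B w).reject t) ↔
      c.q ∈ accept := by
  constructor
  · intro h
    obtain ⟨h1, h2⟩ := StateTransition.mem_eval.1 hc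
    obtain ⟨pos, h3⟩ := exists_tracked h1 0
    have hpos := hB _ _ h3
    by_contra hacc
    refine h _ _ _ _ ((reaches_iff hB).2 ⟨_, h3, rfl⟩)
      ((fires_iff (headCell_le hpos) rfl).2 ⟨rfl, rfl, rfl⟩) ⟨_, _, rfl, ?_, hacc⟩
    rw [cellTape_headCell (c := (c, pos)) hpos]
    simpa [TM0.step] using h2
  · rintro hacc O t a b hO hf ⟨p, y, ht, hM, hy⟩
    obtain ⟨c', h1, rfl⟩ := (reaches_iff hB).1 hO
    have hpos := hB _ _ h1
    obtain ⟨rfl, rfl, rfl⟩ := (fires_iff (headCell_le hpos) rfl).1 hf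
    obtain ⟨rfl, rfl⟩ := index_inj ht
    rw [cellTape_headCell hpos] at hM
    have : c'.1 ∈ StateTransition.eval (TM0.step M) (TM0.init (w.map inp)) := by
      refine StateTransition.mem_eval.2 ⟨reaches_of_tracked h1, ?_⟩
      simp only at hM
      simp [TM0.step, hM]
    rw [Part.mem_unique hc this] at hacc
    exact hy hacc

variable (M inp accept B w) in
/-- The anonymous game that simulates a Turing machine on the input `w`. -/
noncomputable def game : AnonymousGame :=
  (system M inp accept B w).game (TokenSystem.roleList (system M inp accept B w).maxIndex
    (factList Γ Λ (2 * B + w.length))).get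

theorem hasNonSingletonSink_game (hB : ∀ c pos, StateTransition.Reaches (trackedStep M)
      (TM0.init (w.map inp), 0) (c, pos) → |pos| ≤ B) {c : TM0.Cfg Γ Λ}
    (hc : c ∈ StateTransition.eval (TM0.step M) (TM0.init (w.map inp))) :
    (game M inp accept B w).toStrategicGame.HasNonSingletonSink ↔ c.q ∈ accept :=
  (TokenSystem.hasNonSingletonSink_iff
    (TokenSystem.isRoster_roleList _ (system M inp accept B w) (nodup_factList _))
    (regular_system M inp accept B w) fun _ _ => not_reject_of_produce M inp accept B w).trans
    (not_reject_iff hB hc)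

end MachineTokens

/-! ### Numbers, predicates and loops of stack programs -/

namespace StackCode

section Arithmetic

variable {α : Type} {d : ℕ} {Γ : Fin d → α → List Bool}

theorem PolyTime.congr {f g : α → List Bool} (h : PolyTime Γ f) (e : ∀ a, g a = f a) :
    PolyTime Γ g := by
  rwa [funext e]

theorem PolyTime.const (l : List Bool) : PolyTime Γ fun _ => l := by
  induction l with
  | nil => exact .nil
  | cons b l ih => exact (PolyTime.single b).append ih

theorem PolyTime.last : PolyTime (ext Γ) fun p => p.2 :=
  .var 0

theorem PolyTime.flatMap_const {ι : Type} {f : α → ι → List Bool} (l : List ι)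
    (hf : ∀ i, PolyTime Γ fun a => f a i) : PolyTime Γ fun a => l.flatMap (f a) := by
  induction l with
  | nil => exact .nil
  | cons i l ih => exact (hf i).append ih

/-- A function with natural values can be computed, in unary, in polynomial time. -/
def PolyTimeNat (Γ : Fin d → α → List Bool) (g : α → ℕ) : Prop :=
  PolyTime Γ fun a => List.replicate (g a) true

theorem PolyTimeNat.congr {g g' : α → ℕ} (h : PolyTimeNat Γ g) (e : ∀ a, g' a = g a) :
    PolyTimeNat Γ g' := by
  rwa [funext e]

theorem PolyTimeNat.const (n : ℕ) : PolyTimeNat Γ fun _ => n :=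
  PolyTime.const _

theorem PolyTimeNat.add {g h : α → ℕ} (hg : PolyTimeNat Γ g) (hh : PolyTimeNat Γ h) :
    PolyTimeNat Γ fun a => g a + h a := by
  simpa only [PolyTimeNat, List.replicate_add] using PolyTime.append hg hh

theorem PolyTimeNat.sub {g h : α → ℕ} (hg : PolyTimeNat Γ g) (hh : PolyTimeNat Γ h) :
    PolyTimeNat Γ fun a => g a - h a := by
  simpa only [PolyTimeNat, List.drop_replicate, List.length_replicate] using PolyTime.drop hg hh

/-- Loops over tails become counting loops. Tails get shorter, so the counter descends, as do the
cells in `factList`. -/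
theorem flatMap_tails_length {β : Type} (F : ℕ → List β) (l : List Bool) :
    (l.tails.flatMap fun s => F s.length) = (List.range (l.length + 1)).reverse.flatMap F := by
  induction l with
  | nil => simp
  | cons b l ih =>
    rw [List.tails_cons, List.flatMap_cons, ih, List.length_cons,
      List.range_succ (n := l.length + 1), List.reverse_append,
      List.reverse_singleton, List.singleton_append, List.flatMap_cons]

theorem PolyTime.length {f : α → List Bool} (hf : PolyTime Γ f) :
    PolyTimeNat Γ fun a => (f a).length := by
  -- A list has one more tail than elements; the surplus is subtracted at the end.
  have h : PolyTimeNat Γ fun a => (f a).length + 1 := by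
    refine (hf.flatMap_tails (f := fun _ _ => [true]) (.single true)).congr fun a => ?_
    rw [flatMap_tails_length fun _ => [true], eq_comm, List.eq_replicate_iff]
    simp
  exact h.sub (.const 1)

theorem PolyTimeNat.weaken {g : α → ℕ} (hg : PolyTimeNat Γ g) :
    PolyTimeNat (ext Γ) fun p => g p.1 :=
  PolyTime.weaken hg

theorem PolyTime.flatMap_range_reverse {g : α → ℕ} {F : α → ℕ → List Bool} (hg : PolyTimeNat Γ g)
    (hF : PolyTime (ext Γ) fun p => F p.1 p.2.length) :
    PolyTime Γ fun a => (List.range (g a + 1)).reverse.flatMap (F a) := by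
  refine (PolyTime.flatMap_tails (f := fun a l => F a l.length) hg hF).congr fun a => ?_
  rw [flatMap_tails_length, List.length_replicate]

theorem PolyTime.length_iff {g : α → ℕ} {f : α → List Bool} (hf : PolyTime Γ f)
    (h : ∀ a, (f a).length = g a) : PolyTimeNat Γ g :=
  hf.length.congr fun a => (h a).symm

theorem PolyTimeNat.mul {g h : α → ℕ} (hg : PolyTimeNat Γ g) (hh : PolyTimeNat Γ h) :
    PolyTimeNat Γ fun a => g a * h a := by
  have h1 : PolyTimeNat Γ fun a => (g a + 1) * h a := by
    refine (PolyTime.flatMap_range_reverse (F := fun a _ => List.replicate (h a) true) hg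
      hh.weaken).length_iff fun a => ?_
    simp [List.length_flatMap]
  exact (h1.sub hh).congr fun a => by rw [add_mul, one_mul, Nat.add_sub_cancel]

theorem PolyTimeNat.polynomial {g : α → ℕ} (hg : PolyTimeNat Γ g) (P : Polynomial ℕ) :
    PolyTimeNat Γ fun a => P.eval (g a) := by
  have hpow : ∀ n : ℕ, PolyTimeNat Γ fun a => g a ^ n := by
    intro n
    induction n with
    | zero => exact .const 1
    | succ n ih => exact (ih.mul hg).congr fun a => pow_succ _ _
  induction P using Polynomial.induction_on' with
  | add P Q hP hQ => exact (hP.add hQ).congr fun a => Polynomial.eval_add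
  | monomial n c =>
    exact ((PolyTimeNat.const c).mul (hpow n)).congr fun a => Polynomial.eval_monomial

open Classical in
/-- A predicate can be decided in polynomial time. -/
def PolyTimePred (Γ : Fin d → α → List Bool) (p : α → Prop) : Prop :=
  PolyTime Γ fun a => if p a then [true] else []

theorem PolyTimePred.congr {p q : α → Prop} (hp : PolyTimePred Γ p) (e : ∀ a, q a ↔ p a) :
    PolyTimePred Γ q := by
  rwa [funext fun a => propext (e a)]

theorem PolyTimePred.const (q : Prop) : PolyTimePred Γ fun _ => q :=
  PolyTime.const _

theorem PolyTime.ite {p : α → Prop} [∀ a, Decidable (p a)] {f g : α → List Bool}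
    (hp : PolyTimePred Γ p) (hf : PolyTime Γ f) (hg : PolyTime Γ g) :
    PolyTime Γ fun a => if p a then f a else g a := by
  refine (PolyTime.headCases hp hg hf hg).congr fun a => ?_
  by_cases h : p a <;> simp [h, StackCode.headCases]

theorem PolyTimePred.and {p q : α → Prop} (hp : PolyTimePred Γ p) (hq : PolyTimePred Γ q) :
    PolyTimePred Γ fun a => p a ∧ q a := by
  classical
  refine (PolyTime.ite hp hq .nil).congr fun a => ?_
  by_cases h : p a <;> simp [h]

theorem PolyTimePred.not {p : α → Prop} (hp : PolyTimePred Γ p) : PolyTimePred Γ fun a => ¬p a := by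
  classical
  refine (PolyTime.ite hp .nil (.single true)).congr fun a => ?_
  by_cases h : p a <;> simp [h]

theorem PolyTimePred.or {p q : α → Prop} (hp : PolyTimePred Γ p) (hq : PolyTimePred Γ q) :
    PolyTimePred Γ fun a => p a ∨ q a :=
  (hp.not.and hq.not).not.congr fun a => by tauto

theorem PolyTimePred.le {g h : α → ℕ} (hg : PolyTimeNat Γ g) (hh : PolyTimeNat Γ h) :
    PolyTimePred Γ fun a => g a ≤ h a := by
  classical
  refine (PolyTime.headCases (hg.sub hh) (.single true) .nil .nil).congr fun a => ?_
  by_cases hle : g a ≤ h a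
  · simp [hle, Nat.sub_eq_zero_of_le hle, StackCode.headCases]
  · obtain ⟨k, hk⟩ : ∃ k, g a - h a = k + 1 := ⟨g a - h a - 1, by omega⟩
    simp [hle, hk, List.replicate_succ, StackCode.headCases]

theorem PolyTimePred.eq {g h : α → ℕ} (hg : PolyTimeNat Γ g) (hh : PolyTimeNat Γ h) :
    PolyTimePred Γ fun a => g a = h a :=
  ((le hg hh).and (le hh hg)).congr fun _ => le_antisymm_iff

theorem PolyTimePred.lt {g h : α → ℕ} (hg : PolyTimeNat Γ g) (hh : PolyTimeNat Γ h) :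
    PolyTimePred Γ fun a => g a < h a :=
  (le hh hg).not.congr fun _ => not_le.symm

theorem PolyTimePred.ne_nil {f : α → List Bool} (hf : PolyTime Γ f) :
    PolyTimePred Γ fun a => f a ≠ [] :=
  (lt (.const 0) hf.length).congr fun _ => List.length_pos_iff.symm

/-- The search loop outputs one symbol per witness, and a witness exists if and only if the output
is nonempty. -/
theorem PolyTimePred.exists_le {g : α → ℕ} {P : α → ℕ → Prop} (hg : PolyTimeNat Γ g)
    (hP : PolyTimePred (ext Γ) fun p => P p.1 p.2.length) :
    PolyTimePred Γ fun a => ∃ n ≤ g a, P a n := by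
  classical
  refine (PolyTimePred.ne_nil (PolyTime.flatMap_range_reverse
    (F := fun a n => if P a n then [true] else []) hg ?_)).congr fun a => ?_
  · unfold PolyTimePred at hP
    convert hP
  · simp [List.flatMap_eq_nil_iff]

theorem PolyTimePred.exists_finite {ι : Type} [Finite ι] {P : α → ι → Prop}
    (hP : ∀ i, PolyTimePred Γ fun a => P a i) : PolyTimePred Γ fun a => ∃ i, P a i := by
  have h : ∀ l : List ι, PolyTimePred Γ fun a => ∃ i ∈ l, P a i := by
    intro l
    induction l with
    | nil => exact (PolyTimePred.const False).congr fun a => by simp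
    | cons i l ih => exact ((hP i).or ih).congr fun a => by simp
  have := Fintype.ofFinite ι
  exact (h (Finset.univ : Finset ι).toList).congr fun a => by simp

/-- A function with integer values can be computed in polynomial time. -/
def PolyTimeInt (Γ : Fin d → α → List Bool) (z : α → ℤ) : Prop :=
  PolyTime Γ fun a => AnonymousGame.encodeInt (z a)

theorem PolyTimeInt.const (z : ℤ) : PolyTimeInt Γ fun _ => z :=
  PolyTime.const _

theorem PolyTimeInt.ite {p : α → Prop} {_ : ∀ a, Decidable (p a)} {f g : α → ℤ}
    (hp : PolyTimePred Γ p) (hf : PolyTimeInt Γ f) (hg : PolyTimeInt Γ g) :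
    PolyTimeInt Γ fun a => if p a then f a else g a := by
  simpa only [PolyTimeInt, apply_ite] using PolyTime.ite hp hf hg

end Arithmetic

/-- The projection `π` makes the variables of `Γ` available to programs with the variables `Δ`. -/
def Extends {α β : Type} {d e : ℕ} (Γ : Fin d → α → List Bool) (Δ : Fin e → β → List Bool)
    (π : β → α) : Prop :=
  ∀ ⦃f : α → List Bool⦄, PolyTime Γ f → PolyTime Δ fun b => f (π b)

theorem extends_ext {α : Type} {d : ℕ} (Γ : Fin d → α → List Bool) : Extends Γ (ext Γ) Prod.fst :=
  fun _ hf => hf.weaken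

theorem Extends.nat {α β : Type} {d e : ℕ} {Γ : Fin d → α → List Bool} {Δ : Fin e → β → List Bool}
    {π : β → α} (h : Extends Γ Δ π) {g : α → ℕ} (hg : PolyTimeNat Γ g) :
    PolyTimeNat Δ fun b => g (π b) :=
  h hg

theorem antidiagonal_eq_map_reverse (n : ℕ) : List.Nat.antidiagonal n =
    (List.range (n + 1)).reverse.map fun i => (n - i, i) := by
  refine List.ext_getElem (by simp) fun i h1 h2 => ?_
  simp at h1
  simp [List.Nat.antidiagonal]
  omega

/-- Recursion on `k` nests counting loops, whose number is constant. Each loop adds a variable, so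
the assumption on the body must cover every context that extends the given one. -/
theorem PolyTime.flatMap_antidiagonalTuple (k : ℕ) {α : Type} {d : ℕ} {Γ : Fin d → α → List Bool}
    {g : α → ℕ} {F : α → (Fin k → ℕ) → List Bool} (hg : PolyTimeNat Γ g)
    (hF : ∀ {β : Type} {e : ℕ} (Δ : Fin e → β → List Bool) (π : β → α) (c : β → Fin k → ℕ),
      Extends Γ Δ π → (∀ i, PolyTimeNat Δ fun b => c b i) → PolyTime Δ fun b => F (π b) (c b)) :
    PolyTime Γ fun a => (List.Nat.antidiagonalTuple k (g a)).flatMap (F a) := by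
  induction k generalizing α d with
  | zero =>
    have h1 := hF Γ id (fun _ => ![]) (fun _ hf => hf) fun i => i.elim0
    refine (PolyTime.ite (PolyTimePred.le hg (.const 0)) h1 .nil).congr fun a => ?_
    rcases g a with _ | n <;> simp
  | succ k ih =>
    have h1 : PolyTime Γ fun a => (List.range (g a + 1)).reverse.flatMap fun i =>
        (List.Nat.antidiagonalTuple k i).flatMap fun c => F a (Fin.cons (g a - i) c) := by
      refine PolyTime.flatMap_range_reverse hg (ih (g := fun p : α × List Bool => p.2.length)
        (F := fun p c => F p.1 (Fin.cons (g p.1 - p.2.length) c)) PolyTime.last.length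
        fun Δ π c hπ hc => ?_)
      refine hF Δ (fun b => (π b).1) _ (fun f hf => hπ hf.weaken) fun i => ?_
      cases i using Fin.cases with
      | zero => exact hπ.nat (hg.weaken.sub PolyTime.last.length)
      | succ i => exact hc i
    refine h1.congr fun a => ?_
    rw [List.Nat.antidiagonalTuple, antidiagonal_eq_map_reverse, List.flatMap_assoc,
      List.flatMap_map]
    simp only [List.flatMap_map]

end StackCode

/-! ### The encoding of a token game as nested concatenations. -/

namespace TokenSystem

theorem encode_game {F : Type} (σ : TokenSystem F) (roles : List (Role F)) :
    (σ.game roles.get).encode =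
      List.replicate roles.length true ++ false :: (List.replicate 5 true ++ false ::
        roles.flatMap fun r => (List.finRange 5).flatMap fun a =>
          (List.Nat.antidiagonalTuple 5 (roles.length - 1)).flatMap fun c =>
            AnonymousGame.encodeInt (σ.utility r a c)) := by
  have h1 : ∀ r a, ((AnonymousGame.partitionList 5 (roles.length - 1)).flatMap fun c =>
      AnonymousGame.encodeInt (σ.utility r a c.1)) =
      (List.Nat.antidiagonalTuple 5 (roles.length - 1)).flatMap fun c =>
        AnonymousGame.encodeInt (σ.utility r a c) := by
    intro r a
    rw [← List.flatMap_map Subtype.val fun c => AnonymousGame.encodeInt (σ.utility r a c),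
      AnonymousGame.partitionList, List.attachWith_map_subtype_val]
  have h2 : (AnonymousGame.tableIndices roles.length 5).flatMap (fun x =>
      AnonymousGame.encodeInt (σ.utility (roles.get x.1) x.2.1 x.2.2.1)) =
      (List.finRange roles.length).flatMap fun i => (List.finRange 5).flatMap fun a =>
        (AnonymousGame.partitionList 5 (roles.length - 1)).flatMap fun c =>
          AnonymousGame.encodeInt (σ.utility (roles.get i) a c.1) := by
    simp only [AnonymousGame.tableIndices, SProd.sprod, List.product, List.flatMap_assoc,
      List.flatMap_map]
  simp only [h1] at h2
  rw [← List.flatMap_map roles.get fun r => (List.finRange 5).flatMap fun a =>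
    (List.Nat.antidiagonalTuple 5 (roles.length - 1)).flatMap fun c =>
      AnonymousGame.encodeInt (σ.utility r a c), List.map_get_finRange] at h2
  rw [← h2]
  rfl

theorem phaseOf_eq_consume {c : Fin 5 → ℕ} : phaseOf c = .consume ↔ 0 < c 3 := by
  unfold phaseOf
  split_ifs <;> simp_all

theorem phaseOf_eq_produce {c : Fin 5 → ℕ} : phaseOf c = .produce ↔ ¬0 < c 3 ∧ 0 < c 4 := by
  unfold phaseOf
  split_ifs <;> simp_all

theorem phaseOf_eq_reset {c : Fin 5 → ℕ} : phaseOf c = .reset ↔ ¬0 < c 3 ∧ ¬0 < c 4 := by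
  unfold phaseOf
  split_ifs <;> simp_all

end TokenSystem

/-! ### Polynomial-time computation of the utility table. -/

namespace MachineTokens

open Turing StackCode

variable {Γ Λ : Type} [Inhabited Γ] [Inhabited Λ] [Fintype Γ] [Fintype Λ]
  (M : TM0.Machine Γ Λ) (inp : Bool → Γ) (accept : Set Λ)

section Utility

variable {α : Type} {d : ℕ} {Δ : Fin d → α → List Bool} {B t p : α → ℕ} {w : α → List Bool}

omit [Inhabited Γ] [Inhabited Λ] in
theorem polyTimeNat_index (hp : PolyTimeNat Δ p) (y : Λ × Γ) :
    PolyTimeNat Δ fun a => index (p a) y :=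
  ((PolyTimeNat.const _).mul (hp.add (.const 1))).add (.const _)

omit [Inhabited Γ] [Inhabited Λ] [Fintype Γ] [Fintype Λ] in
theorem polyTimeNat_target (hp : PolyTimeNat Δ p) (z : TM0.Stmt Γ) :
    PolyTimeNat Δ fun a => target (p a) z := by
  rcases z with (_ | _) | y
  · exact hp.add (.const 1)
  · exact hp.sub (.const 1)
  · exact hp

/-- This bounds the search for the cell that belongs to a given index. -/
theorem le_index (p : ℕ) (y : Λ × Γ) : p ≤ index p y := by
  have : 0 < Fintype.card (Λ × Γ) := Fintype.card_pos_iff.2 ⟨default⟩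
  have := Nat.le_mul_of_pos_left (p + 1) this
  unfold index
  omega

theorem polyTimePred_consume₁ (ht : PolyTimeNat Δ t) (hp : PolyTimeNat Δ p) (x : Λ ⊕ Γ) :
    PolyTimePred Δ fun a => (system M inp accept (B a) (w a)).consume₁ (t a) (p a, x) := by
  refine (PolyTimePred.exists_finite fun y : Λ × Γ =>
    (PolyTimePred.eq ht (polyTimeNat_index hp y)).and (.const (x = .inl y.1))).congr fun a => ?_
  simp only [system, Prod.mk.injEq]
  constructor
  · rintro ⟨p', y, h1, rfl, h2⟩
    exact ⟨y, h1, h2⟩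
  · rintro ⟨y, h1, h2⟩
    exact ⟨_, y, h1, rfl, h2⟩

theorem polyTimePred_consume₂ (ht : PolyTimeNat Δ t) (hp : PolyTimeNat Δ p) (x : Λ ⊕ Γ) :
    PolyTimePred Δ fun a => (system M inp accept (B a) (w a)).consume₂ (t a) (p a, x) := by
  refine (PolyTimePred.exists_finite fun y : Λ × Γ =>
    (PolyTimePred.eq ht (polyTimeNat_index hp y)).and (.const (x = .inr y.2))).congr fun a => ?_
  simp only [system, Prod.mk.injEq]
  constructor
  · rintro ⟨p', y, h1, rfl, h2⟩
    exact ⟨y, h1, h2⟩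
  · rintro ⟨y, h1, h2⟩
    exact ⟨_, y, h1, rfl, h2⟩

theorem polyTimePred_exists_transition {P : α → ℕ → Λ × Γ → Λ × TM0.Stmt Γ → Prop}
    (ht : PolyTimeNat Δ t)
    (hP : ∀ y z, PolyTimePred (ext Δ) fun a => P a.1 a.2.length y z) :
    PolyTimePred Δ fun a => ∃ (p : ℕ) (y : Λ × Γ) (z : Λ × TM0.Stmt Γ), t a = index p y ∧
      M y.1 y.2 = some z ∧ P a p y z := by
  refine (PolyTimePred.exists_le (P := fun a p => ∃ (y : Λ × Γ) (z : Λ × TM0.Stmt Γ),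
    t a = index p y ∧ M y.1 y.2 = some z ∧ P a p y z) ht (PolyTimePred.exists_finite
    (P := fun (a : α × List Bool) (y : Λ × Γ) => ∃ z, t a.1 = index a.2.length y ∧
      M y.1 y.2 = some z ∧ P a.1 a.2.length y z)
    fun y => ?_)).congr fun a => ?_
  · rcases hM : M y.1 y.2 with _ | z
    · exact (PolyTimePred.const False).congr fun a => by simp
    · exact ((PolyTimePred.eq ht.weaken (polyTimeNat_index PolyTime.last.length y)).and
        (hP y z)).congr fun a => by simp
  · constructor
    · rintro ⟨p, y, z, h⟩
      exact ⟨p, h.1 ▸ le_index p y, y, z, h⟩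
    · rintro ⟨p, -, y, z, h⟩
      exact ⟨p, y, z, h⟩

theorem polyTimePred_produce₁ (ht : PolyTimeNat Δ t) (hp : PolyTimeNat Δ p) (x : Λ ⊕ Γ) :
    PolyTimePred Δ fun a => (system M inp accept (B a) (w a)).produce₁ (t a) (p a, x) := by
  refine (polyTimePred_exists_transition M ht (P := fun a i y z =>
    p a = target i z.2 ∧ x = .inl z.1) fun y z => (PolyTimePred.eq hp.weaken
      (polyTimeNat_target PolyTime.last.length z.2)).and (.const _)).congr fun a => ?_
  simp only [system, Prod.mk.injEq]

theorem polyTimePred_produce₂ (ht : PolyTimeNat Δ t) (hp : PolyTimeNat Δ p) (x : Λ ⊕ Γ) :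
    PolyTimePred Δ fun a => (system M inp accept (B a) (w a)).produce₂ (t a) (p a, x) := by
  refine (polyTimePred_exists_transition M ht (P := fun a i y z =>
    p a = i ∧ x = .inr (written y.2 z.2)) fun y z => (PolyTimePred.eq hp.weaken
      PolyTime.last.length).and (.const _)).congr fun a => ?_
  simp only [system, Prod.mk.injEq]

theorem polyTimePred_reject (ht : PolyTimeNat Δ t) :
    PolyTimePred Δ fun a => (system M inp accept (B a) (w a)).reject (t a) := by
  refine (PolyTimePred.exists_le (P := fun a p => ∃ y : Λ × Γ, t a = index p y ∧
    M y.1 y.2 = none ∧ y.1 ∉ accept) ht (PolyTimePred.exists_finite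
    (P := fun (a : α × List Bool) (y : Λ × Γ) => t a.1 = index a.2.length y ∧
      M y.1 y.2 = none ∧ y.1 ∉ accept) fun y =>
      (PolyTimePred.eq ht.weaken (polyTimeNat_index PolyTime.last.length y)).and
        (.const _))).congr fun a => ?_
  simp only [system]
  constructor
  · rintro ⟨p, y, h⟩
    exact ⟨p, h.1 ▸ le_index p y, y, h⟩
  · rintro ⟨p, -, y, h⟩
    exact ⟨p, y, h⟩

omit [Fintype Γ] in
-- Dropping `B + w.length - p` letters brings the wanted letter to the front; an exhausted list
-- means a blank.
theorem polyTimePred_initialTape (hB : PolyTimeNat Δ B) (hw : PolyTime Δ w) (hp : PolyTimeNat Δ p)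
    (x : Γ) : PolyTimePred Δ fun a => initialTape inp (B a) (w a) (p a) = x := by
  classical
  have hs := hB.add hw.length
  refine (PolyTime.ite (PolyTimePred.le hp hs) (PolyTime.headCases (hw.drop (hs.sub hp))
    (PolyTimePred.const (default = x)) (PolyTimePred.const (inp true = x))
    (PolyTimePred.const (inp false = x))) (PolyTimePred.const (default = x))).congr fun a => ?_
  by_cases h : p a ≤ B a + (w a).length
  · simp only [initialTape, h, if_true, List.length_replicate]
    generalize B a + (w a).length - p a = i
    generalize w a = l
    induction l generalizing i with
    | nil => simp [StackCode.headCases]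
    | cons b l ih =>
      cases i with
      | zero => cases b <;> simp [StackCode.headCases]
      | succ i => simpa using ih i
  · simp [initialTape, h]

theorem polyTimePred_initial (hB : PolyTimeNat Δ B) (hw : PolyTime Δ w) (hp : PolyTimeNat Δ p)
    (x : Λ ⊕ Γ) : PolyTimePred Δ fun a => (system M inp accept (B a) (w a)).initial (p a, x) := by
  rcases x with q | x
  · exact ((PolyTimePred.eq hp (hB.add hw.length)).and (.const (q = default))).congr fun a => by
      simp [system]
  · exact (polyTimePred_initialTape inp hB hw hp x).congr fun a => by simp [system, eq_comm]

variable {c : α → Fin 5 → ℕ}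

omit [Inhabited Γ] [Inhabited Λ] [Fintype Γ] [Fintype Λ] in
theorem polyTimePred_phaseOf (hc : ∀ b, PolyTimeNat Δ fun a => c a b) (ph : Phase) :
    PolyTimePred Δ fun a => TokenSystem.phaseOf (c a) = ph := by
  have h3 := PolyTimePred.lt (.const 0) (hc 3)
  have h4 := PolyTimePred.lt (.const 0) (hc 4)
  cases ph
  · exact (h3.not.and h4.not).congr fun a => TokenSystem.phaseOf_eq_reset
  · exact h3.congr fun a => TokenSystem.phaseOf_eq_consume
  · exact (h3.not.and h4).congr fun a => TokenSystem.phaseOf_eq_produce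

theorem polyTimeNat_size (hB : PolyTimeNat Δ B) (hw : PolyTime Δ w) :
    PolyTimeNat Δ fun a => (system M inp accept (B a) (w a)).size :=
  ((PolyTimeNat.const 2).mul hB).add hw.length

theorem polyTimeInt_rank (hB : PolyTimeNat Δ B) (hw : PolyTime Δ w) {f : α → ℕ}
    (ht : PolyTimeNat Δ t) (hf : PolyTimeNat Δ f) (ph : Phase) :
    PolyTimeInt Δ fun a => (system M inp accept (B a) (w a)).rank (t a) (f a) ph := by
  have hs := polyTimeNat_size M inp accept hB hw
  have h0 := (PolyTimePred.eq hf (.const 0)).and (.eq ht (.const 0))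
  cases ph
  · exact .ite h0 (.const 2) (.const 3)
  · exact .ite (.and (.eq hf (hs.add (.const 2))) (.eq ht (.const 0))) (.const 2)
      (.ite (.and (.eq hf hs) (polyTimePred_reject M inp accept ht)) (.const 3) (.const 1))
  · exact .ite h0 (.const 3) (.ite (.eq hf hs) (.const 2) (.const 1))

theorem polyTimeInt_utility_ctrl (hB : PolyTimeNat Δ B) (hw : PolyTime Δ w)
    (hc : ∀ b, PolyTimeNat Δ fun a => c a b) (s : Fin 5) :
    PolyTimeInt Δ fun a => (system M inp accept (B a) (w a)).utility .ctrl s (c a) :=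
  have h := polyTimeInt_rank M inp accept hB hw (hc 2) (hc 1)
  .ite (.const _) (h _) (.ite (.const _) (h _) (.ite (.const _) (h _) (.const 0)))

theorem polyTimeInt_utility_pool (hB : PolyTimeNat Δ B) (hw : PolyTime Δ w)
    (hc : ∀ b, PolyTimeNat Δ fun a => c a b) (s : Fin 5) :
    PolyTimeInt Δ fun a => (system M inp accept (B a) (w a)).utility .pool s (c a) := by
  have hs := (polyTimeNat_size M inp accept hB hw).add (.const 2)
  have hf := PolyTimePred.eq (hc 1) hs
  exact .ite (.const _)
    (.ite (.or (polyTimePred_phaseOf hc _) (.and (polyTimePred_phaseOf hc _) hf))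
      (.const 2) (.const 1))
    (.ite (.const _) (.ite (.and (polyTimePred_phaseOf hc _) hf) (.const 2) (.const 1)) (.const 0))

theorem polyTimeInt_utility_fact (hB : PolyTimeNat Δ B) (hw : PolyTime Δ w)
    (hc : ∀ b, PolyTimeNat Δ fun a => c a b) (hp : PolyTimeNat Δ p) (x : Λ ⊕ Γ) (s : Fin 5) :
    PolyTimeInt Δ fun a =>
      (system M inp accept (B a) (w a)).utility (.fact (p a, x)) s (c a) := by
  have hs := polyTimeNat_size M inp accept hB hw
  have hs1 := PolyTimePred.eq (hc 1) (hs.add (.const 1))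
  have hs0 := PolyTimePred.eq (hc 1) hs
  refine .ite (.const _) (.ite ?_ (.const 2) (.const 1))
    (.ite (.const _) (.ite ?_ (.const 2) (.const 1)) (.const 0))
  · exact .or (polyTimePred_phaseOf hc _) (.and (polyTimePred_phaseOf hc _)
      (.or (.and hs1 (polyTimePred_consume₁ M inp accept (hc 2) hp x))
        (.and hs0 (polyTimePred_consume₂ M inp accept (hc 2) hp x))))
  · exact .and (polyTimePred_phaseOf hc _) (.or (.and (.eq (hc 2) (.const 0))
      (.and (.lt (hc 1) (hs.add (.const 2))) (polyTimePred_initial M inp accept hB hw hp x)))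
      (.or (.and hs0 (polyTimePred_produce₁ M inp accept (hc 2) hp x))
        (.and hs1 (polyTimePred_produce₂ M inp accept (hc 2) hp x))))

omit [Inhabited Γ] [Inhabited Λ] in
theorem PolyTime.flatMap_roleList {m n : α → ℕ} {F : α → Role (Fact Γ Λ) → List Bool}
    (hm : PolyTimeNat Δ m) (hn : PolyTimeNat Δ n) (hctrl : PolyTime Δ fun a => F a .ctrl)
    (hpool : PolyTime Δ fun a => F a .pool)
    (hfact : ∀ x, PolyTime (ext Δ) fun a => F a.1 (.fact (a.2.length, x))) :
    PolyTime Δ fun a =>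
      (TokenSystem.roleList (m a) (factList Γ Λ (n a))).flatMap (F a) := by
  have h1 : PolyTime Δ fun a => (List.range (m a - 1 + 1)).reverse.flatMap fun _ => F a .pool :=
    PolyTime.flatMap_range_reverse (F := fun a _ => F a .pool) (hm.sub (.const 1)) hpool.weaken
  have h2 : PolyTime Δ fun a => (List.replicate (m a) Role.pool).flatMap (F a) := by
    classical
    -- Counting loops run at least once, so `m a = 0` is treated separately.
    refine (PolyTime.ite (PolyTimePred.eq hm (.const 0)) .nil h1).congr fun a => ?_
    split_ifs with h
    · simp [h]
    · rw [Nat.sub_add_cancel (Nat.pos_of_ne_zero h)]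
      generalize m a = k
      induction k with
      | zero => rfl
      | succ k ih => simp [List.replicate_succ, List.range_succ, ih]
  refine (hctrl.append (h2.append (PolyTime.flatMap_range_reverse
    (F := fun a p => (Finset.univ : Finset (Λ ⊕ Γ)).toList.flatMap fun x => F a (.fact (p, x))) hn
    (PolyTime.flatMap_const
    (f := fun (a : α × List Bool) x => F a.1 (.fact (a.2.length, x)))
    (Finset.univ : Finset (Λ ⊕ Γ)).toList
    hfact)))).congr fun a => ?_
  simp [TokenSystem.roleList, factList, List.flatMap_append, List.flatMap_map, List.flatMap_assoc]

theorem polyTime_encode_game (hB : PolyTimeNat Δ B) (hw : PolyTime Δ w) :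
    PolyTime Δ fun a => (game M inp accept (B a) (w a)).encode := by
  have hn := polyTimeNat_size M inp accept hB hw
  have hm : PolyTimeNat Δ fun a => (system M inp accept (B a) (w a)).maxIndex :=
    (PolyTimeNat.const _).mul (hn.add (.const 2))
  -- Writing one symbol per role gives the number of players in unary.
  have hlen : PolyTimeNat Δ fun a => (TokenSystem.roleList
      (system M inp accept (B a) (w a)).maxIndex (factList Γ Λ (2 * B a + (w a).length))).length :=
    (PolyTime.flatMap_roleList (F := fun (_ : α) (_ : Role (Fact Γ Λ)) => [true]) hm hn
      (.single _) (.single _)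
      fun _ => .single _).length_iff fun a => by
        simp [List.length_flatMap]
        rfl
  have hk := hlen.sub (.const 1)
  have htable := PolyTime.flatMap_roleList (Γ := Γ) (Λ := Λ)
    (F := fun a r => (List.finRange 5).flatMap fun s =>
      (List.Nat.antidiagonalTuple 5 ((TokenSystem.roleList
        (system M inp accept (B a) (w a)).maxIndex (factList Γ Λ (2 * B a + (w a).length))).length - 1)).flatMap
          fun c => AnonymousGame.encodeInt ((system M inp accept (B a) (w a)).utility r s c)) hm hn
    (PolyTime.flatMap_const _ fun s => PolyTime.flatMap_antidiagonalTuple 5 hk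
      fun Δ' π c hπ hc => ?_)
    (PolyTime.flatMap_const _ fun s => PolyTime.flatMap_antidiagonalTuple 5 hk
      fun Δ' π c hπ hc => ?_)
    (fun x => PolyTime.flatMap_const _ fun s => PolyTime.flatMap_antidiagonalTuple 5 hk.weaken
      fun Δ' π c hπ hc => ?_)
  · exact (PolyTime.append hlen ((PolyTime.single false).append ((PolyTime.const
      (List.replicate 5 true)).append ((PolyTime.single false).append htable)))).congr
        fun a => TokenSystem.encode_game _ _
  · exact polyTimeInt_utility_ctrl M inp accept (hπ.nat hB) (hπ hw) hc s
  · exact polyTimeInt_utility_pool M inp accept (hπ.nat hB) (hπ hw) hc s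
  · exact polyTimeInt_utility_fact M inp accept (hπ.nat hB.weaken) (hπ hw.weaken) hc
      (hπ.nat PolyTime.last.length) x s

end Utility

end MachineTokens

open MachineTokens StackCode in
/-- HAS A NON-SINGLETON SINK is PSPACE-hard for anonymous games with five strategies. -/
theorem isPSPACEHardOn_numStrategies :
    IsPSPACEHardOn AnonymousGame.encoding {G | G.numStrategies = 5}
      (fun G => G.toStrategicGame.HasNonSingletonSink) := by
  rintro L ⟨D⟩
  classical
  have := D.finiteΓ
  have := D.finiteΛ
  let := D.inhabitedΓ
  let := D.inhabitedΛ
  let := Fintype.ofFinite D.Γ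
  let := Fintype.ofFinite D.Λ
  have hw : PolyTime (fun _ : Fin 1 => (id : List Bool → List Bool)) fun w => w := .var 0
  refine ⟨fun w => game D.machine D.inputSymbol D.accept (D.space.eval w.length) w,
    (polyTime_encode_game _ _ _ (hw.length.polynomial D.space) hw).nonempty_tm2,
    fun w => ⟨rfl, ?_⟩⟩
  obtain ⟨c, hc, h⟩ := D.decides w
  rw [← h]
  exact (hasNonSingletonSink_game (D.space_bound w) hc).symm

/-- HAS A NON-SINGLETON SINK is PSPACE-hard for anonymous games, even for a constant-size
strategy set. -/
theorem mainTheorem4 :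
    IsPSPACEHardOn AnonymousGame.encoding Set.univ
        (fun G => G.toStrategicGame.HasNonSingletonSink) ∧
      ∃ k : ℕ, IsPSPACEHardOn AnonymousGame.encoding {G | G.numStrategies = k}
        (fun G => G.toStrategicGame.HasNonSingletonSink) := by
  refine ⟨fun L hL => ?_, 5, isPSPACEHardOn_numStrategies⟩
  obtain ⟨f, hf, h⟩ := isPSPACEHardOn_numStrategies L hL
  exact ⟨f, hf, fun w => ⟨Set.mem_univ _, (h w).2⟩⟩
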